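/- For $\boldsymbol\theta=(\tau,\mu,\xi)\in\mathbb{R}^3$ with $\tau>0$ let $P_{\boldsymbol\theta}$ be the generalized extreme value (GEV) distribution, with distribution function $\exp\{-[1+\xi(y-\mu)/\tau]^{-1/\xi}\}$ where $1+\xi(y-\mu)/\tau>0$ if $\xi\neq0$, and $\exp\{-\exp[-(y-\mu)/\tau]\}$ if $\xi=0$, and let $p(\cdot\,|\,\boldsymbol\theta)$ be its density (equal to $0$ off the support). Let $\Theta=\{\boldsymbol\theta:\tau>0,\ \xi>-1/2\}$ and $B_r(\boldsymbol\theta)=\{\boldsymbol\theta'\in\Theta:\|\boldsymbol\theta'-\boldsymbol\theta\|<r\}$. Let $\boldsymbol\theta_0\in\Theta$ and let $Y_1,Y_2,\ldots$ be independent with distribution $P_{\boldsymbol\theta_0}$. Let $\pi\ge0$ be a (proper or improper) prior density on $\Theta$ that is locally integrable on $\Theta$, and positive and continuous at $\boldsymbol\theta_0$. Put $$\Omega_n=\bigcap_{i=1}^n\{\boldsymbol\theta\in\Theta:p(Y_i\,|\,\boldsymbol\theta)>0\},\qquad C_n=\int_\Theta\prod_{i=1}^n p(Y_i\,|\,\boldsymbol\theta)\,\pi(\boldsymbol\theta)\,d\boldsymbol\theta,\qquad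 \pi_n(\boldsymbol\theta)=\frac1{C_n}\prod_{i=1}^n p(Y_i\,|\,\boldsymbol\theta)\,\pi(\boldsymbol\theta),$$ with $\pi_n=0$ if $C_n=\infty$. Let $r>0$, and let $K\subset\Theta$ be a compact neighbourhood of $\boldsymbol\theta_0$ with $B_r(\boldsymbol\theta_0)\subset K$. Then, almost surely, $C_n>0$ for all large $n$ and $$\lim_{n\to\infty}\int_{(K\cap\Omega_n)\setminus B_r(\boldsymbol\theta_0)}\pi_n(\boldsymbol\theta)\,d\boldsymbol\theta=0 .$$ -/

import Mathlib

open MeasureTheory ProbabilityTheory Filter Topology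
open scoped ENNReal

namespace GEV

/-- Parameter vectors `θ = (τ, μ, ξ)` (scale, location, shape), with the Euclidean norm and
Lebesgue measure of `ℝ³`. -/
abbrev Param : Type := EuclideanSpace ℝ (Fin 3)

/-- The scale `τ`. -/
def scale (θ : Param) : ℝ := θ 0

/-- The location `μ`. -/
def loc (θ : Param) : ℝ := θ 1

/-- The shape `ξ`. -/
def shape (θ : Param) : ℝ := θ 2

/-- The parameter space `Θ = {θ : τ > 0, ξ > -1/2}`. -/
def paramSpace : Set Param := {θ | 0 < scale θ ∧ -(1 / 2 : ℝ) < shape θ}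

/-- `w(θ) = 1 + ξ (y - μ) / τ`. -/
noncomputable def w (θ : Param) (y : ℝ) : ℝ := 1 + shape θ * ((y - loc θ) / scale θ)

open Classical in
/-- The distribution function `P_θ` of the generalized extreme value distribution. Where
`w θ y ≤ 0` the point `y` is below the support if `ξ > 0`, and above it if `ξ < 0`. -/
noncomputable def gevCDF (θ : Param) (y : ℝ) : ℝ :=
  if shape θ = 0 then Real.exp (-Real.exp (-((y - loc θ) / scale θ)))
  else if 0 < w θ y then Real.exp (-(w θ y ^ (-1 / shape θ)))
  else if 0 < shape θ then 0 else 1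

open Classical in
/-- The density `p(y | θ)` of the generalized extreme value distribution. -/
noncomputable def gevPDF (θ : Param) (y : ℝ) : ℝ :=
  if shape θ = 0 then
    (scale θ)⁻¹ * Real.exp (-((y - loc θ) / scale θ))
      * Real.exp (-Real.exp (-((y - loc θ) / scale θ)))
  else if 0 < w θ y then
    (scale θ)⁻¹ * w θ y ^ (-1 / shape θ - 1) * Real.exp (-(w θ y ^ (-1 / shape θ)))
  else 0

/-- On the support, the density is the derivative of the distribution function. -/
theorem hasDerivAt_gevCDF (θ : Param) (y : ℝ) (hτ : 0 < scale θ)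
    (hy : shape θ = 0 ∨ 0 < w θ y) : HasDerivAt (gevCDF θ) (gevPDF θ y) y := by
  by_cases h0 : shape θ = 0
  · have e : gevCDF θ = fun y => Real.exp (-Real.exp (-((y - loc θ) / scale θ))) := by
      funext z; simp [gevCDF, h0]
    rw [e]
    have h1 : HasDerivAt (fun z : ℝ => -((z - loc θ) / scale θ)) (-(1 / scale θ)) y :=
      (((hasDerivAt_id y).sub_const _).div_const _).neg
    refine h1.exp.neg.exp.congr_deriv ?_
    simp only [gevPDF, h0, if_true, Pi.neg_apply]
    field_simp
  · have hw : 0 < w θ y := hy.resolve_left h0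
    have h1 : HasDerivAt (w θ) (shape θ * (1 / scale θ)) y :=
      ((((hasDerivAt_id y).sub_const _).div_const _).const_mul _).const_add _
    have h2 := (h1.rpow_const (p := -1 / shape θ) (Or.inl hw.ne')).neg.exp
    have e : gevCDF θ =ᶠ[𝓝 y] fun z => Real.exp (-(w θ z ^ (-1 / shape θ))) := by
      filter_upwards [h1.continuousAt.eventually (lt_mem_nhds hw)] with z hz
      simp [gevCDF, h0, hz]
    refine (h2.congr_of_eventuallyEq e).congr_deriv ?_
    simp only [gevPDF, h0, hw, if_true, if_false, Pi.neg_apply]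
    field_simp

/-- The random variable `X` has the distribution `P_θ`. -/
def HasGEVLaw {Ω : Type*} [MeasurableSpace Ω] (X : Ω → ℝ) (θ : Param) (P : Measure Ω) : Prop :=
  ∀ y : ℝ, P {ω | X ω ≤ y} = ENNReal.ofReal (gevCDF θ y)

/-- `B_r(θ) = {θ' ∈ Θ : ‖θ' - θ‖ < r}`. -/
def nbhd (θ : Param) (r : ℝ) : Set Param := {θ' | θ' ∈ paramSpace ∧ ‖θ' - θ‖ < r}

/-- `S(y) = {θ ∈ Θ : p(y | θ) > 0}`. -/
def plausible (y : ℝ) : Set Param := {θ | θ ∈ paramSpace ∧ 0 < gevPDF θ y}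

/-- `Ω_n`, the intersection of the `S(Y_i)` over the first `n` observations. -/
def likelihoodDomain (y : ℕ → ℝ) (n : ℕ) : Set Param := ⋂ i ∈ Finset.range n, plausible (y i)

/-- Likelihood of the first `n` observations times the prior density, `∏ p(Y_i | θ) π(θ)`. -/
noncomputable def jointDensity (π : Param → ℝ) (y : ℕ → ℝ) (n : ℕ) (θ : Param) : ℝ :=
  (∏ i ∈ Finset.range n, gevPDF θ (y i)) * π θ

/-- The normalizing constant `C_n = ∫_Θ ∏ p(Y_i | θ) π(θ) dθ`, an element of `[0, ∞]`. -/
noncomputable def normConst (π : Param → ℝ) (y : ℕ → ℝ) (n : ℕ) : ℝ≥0∞ :=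
  ∫⁻ θ in paramSpace, ENNReal.ofReal (jointDensity π y n θ)

/-- The posterior density `π_n(θ) = ∏ p(Y_i | θ) π(θ) / C_n`. -/
noncomputable def posterior (π : Param → ℝ) (y : ℕ → ℝ) (n : ℕ) (θ : Param) : ℝ≥0∞ :=
  ENNReal.ofReal (jointDensity π y n θ) / normConst π y n

end GEV

/-!
The proof compares numerator and denominator of the posterior with the likelihood at `θ₀`.

Both halves use the reduced variable `z = log (1 + ξ x) / ξ`, `x = (y - μ) / τ` (and `z = x` when
`ξ = 0`), in which every density on its support reads
`p(y | θ) = τ⁻¹ exp (-(1 + ξ) z - exp (-z))` and every distribution function `exp (-exp (-z))`.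
Under `P_θ` the variables `z` and `T = exp (-z)` therefore have exponential tails. The formula
`z = x · dslope log 1 (1 + ξ x)` is regular at `ξ = 0`, so the three types of extreme value
distribution are treated at once.

*Numerator.* For a suitable exponent `s < 1`, the moment `E p(Y | θ₀) ^ (-s)` is finite, and since
densities are bounded uniformly near any `θ₁ ∈ Θ`, dominated convergence shows that
`E sup (p(Y | θ) / p(Y | θ₀)) ^ s`, over `θ` in a small ball around `θ₁`, is close to the affinity
`∫ p(y | θ₁) ^ s p(y | θ₀) ^ (1 - s) dy`. The affinity is less than one when `θ₁ ≠ θ₀`, by the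
equality case of the inequality of means and identifiability (`lintegral_rpow_mul_rpow_lt_one`).
By independence and Borel-Cantelli the likelihood ratio is then at most `exp (-c n)` on the ball,
and a finite cover gives the same on the compact set `K \ B_r(θ₀)`
(`exists_likelihood_le_of_isCompact`).

*Denominator.* The usual argument through a Kullback-Leibler neighbourhood of `θ₀` is not available:
when `ξ₀ = 0`, every `θ` with `ξ ≠ 0` has infinite divergence, as its support is a half-line.
Instead, the integral is restricted to a ball whose radius shrinks with `n`.
Moving `θ₀` by `d` lowers `log p(y | θ₀)` by at most `C d exp (b |z|)`
(`exists_exp_neg_mul_gevPDF_le`), and the reduced variables of the first `n` observations are `o(n)`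
(`ae_exists_abs_reduced_le`), so a radius `exp (-o(n))` suffices, and the volume of the ball is
still subexponential. Hence `C_n` is at least `exp (-c n / 2)` times the likelihood of `θ₀`, up to
a constant (`ae_exists_le_normConst`).
-/

namespace GEV

/-! ### The reduced variable, quantiles and identifiability -/

/-- The reduced variable `z = log (1 + ξ x) / ξ` with `x = (y - μ) / τ`, and `z = x` for `ξ = 0`.
Writing `log w = (w - 1) · dslope log 1 w` removes the singularity at `ξ = 0`, so that one formula,
continuous in `θ`, covers every shape. It is meaningful where `w θ y > 0`. -/
noncomputable def reduced (θ : Param) (y : ℝ) : ℝ :=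
  (y - loc θ) / scale θ * dslope Real.log 1 (w θ y)

theorem shape_mul_reduced (θ : Param) (y : ℝ) :
    shape θ * reduced θ y = Real.log (w θ y) := by
  have h := sub_smul_dslope Real.log 1 (w θ y)
  rw [Real.log_one, sub_zero, smul_eq_mul] at h
  rw [← h]
  unfold reduced w
  ring

theorem exp_shape_mul_reduced {θ : Param} {y : ℝ} (hw : 0 < w θ y) :
    Real.exp (shape θ * reduced θ y) = w θ y := by
  rw [shape_mul_reduced, Real.exp_log hw]

theorem w_of_shape_eq_zero {θ : Param} (h : shape θ = 0) (y : ℝ) : w θ y = 1 := by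
  simp [w, h]

theorem reduced_of_shape_eq_zero {θ : Param} (h : shape θ = 0) (y : ℝ) :
    reduced θ y = (y - loc θ) / scale θ := by
  simp [reduced, w_of_shape_eq_zero h]

theorem w_rpow_eq_exp {θ : Param} {y : ℝ} (h : shape θ ≠ 0) (hw : 0 < w θ y) :
    w θ y ^ (-1 / shape θ) = Real.exp (-reduced θ y) := by
  rw [← exp_shape_mul_reduced hw, ← Real.exp_mul]
  congr 1
  field_simp

theorem gevCDF_eq_exp {θ : Param} {y : ℝ} (hw : 0 < w θ y) :
    gevCDF θ y = Real.exp (-Real.exp (-reduced θ y)) := by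
  by_cases h : shape θ = 0
  · simp [gevCDF, h, reduced_of_shape_eq_zero h]
  · simp only [gevCDF, h, hw, if_true, if_false, w_rpow_eq_exp h hw]

theorem gevPDF_eq_exp {θ : Param} {y : ℝ} (hw : 0 < w θ y) :
    gevPDF θ y = (scale θ)⁻¹ *
      Real.exp (-(1 + shape θ) * reduced θ y - Real.exp (-reduced θ y)) := by
  by_cases h : shape θ = 0
  · simp only [gevPDF, h, if_true, reduced_of_shape_eq_zero h, mul_assoc, ← Real.exp_add]
    congr 2
    ring
  · simp only [gevPDF, h, hw, if_true, if_false, w_rpow_eq_exp h hw, mul_assoc]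
    congr 1
    rw [Real.rpow_sub_one hw.ne', w_rpow_eq_exp h hw]
    rw [← exp_shape_mul_reduced hw]
    rw [← Real.exp_sub, ← Real.exp_add]
    congr 1
    ring

theorem gevPDF_eq_zero {θ : Param} {y : ℝ} (hw : w θ y ≤ 0) : gevPDF θ y = 0 := by
  have h : shape θ ≠ 0 := fun h => by
    rw [w_of_shape_eq_zero h] at hw
    linarith
  simp [gevPDF, h, hw.not_gt]

theorem gevPDF_pos {θ : Param} {y : ℝ} (hτ : 0 < scale θ) (hw : 0 < w θ y) :
    0 < gevPDF θ y := by
  rw [gevPDF_eq_exp hw]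
  positivity

theorem gevPDF_nonneg {θ : Param} (hτ : 0 < scale θ) (y : ℝ) : 0 ≤ gevPDF θ y := by
  rcases lt_or_ge 0 (w θ y) with hw | hw
  · exact (gevPDF_pos hτ hw).le
  · exact (gevPDF_eq_zero hw).ge

theorem w_pos_of_gevCDF_mem_Ioo {θ : Param} {y : ℝ} (h0 : 0 < gevCDF θ y)
    (h1 : gevCDF θ y < 1) : 0 < w θ y := by
  by_contra hw
  have h : shape θ ≠ 0 := fun h => hw (by simp [w_of_shape_eq_zero h])
  rw [gevCDF, if_neg h, if_neg hw] at h0 h1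
  split_ifs at h0 h1 <;> linarith

theorem gevCDF_nonneg (θ : Param) (y : ℝ) : 0 ≤ gevCDF θ y := by
  unfold gevCDF
  split_ifs <;> positivity

theorem gevCDF_le_one (θ : Param) (y : ℝ) : gevCDF θ y ≤ 1 := by
  unfold gevCDF
  split_ifs with h1 h2
  · exact Real.exp_le_one_iff.2 (neg_nonpos.2 (Real.exp_pos _).le)
  · exact Real.exp_le_one_iff.2 (neg_nonpos.2 (Real.rpow_nonneg h2.le _))
  · exact zero_le_one
  · exact le_rfl

/-- The point at which the reduced variable takes the value `z`, that is, the quantile of `P_θ` at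
the level `exp (-exp (-z))`. -/
noncomputable def quantile (θ : Param) (z : ℝ) : ℝ :=
  loc θ + scale θ * (z * dslope Real.exp 0 (shape θ * z))

theorem shape_mul_dslope_exp (ξ z : ℝ) :
    ξ * (z * dslope Real.exp 0 (ξ * z)) = Real.exp (ξ * z) - 1 := by
  have h := sub_smul_dslope Real.exp 0 (ξ * z)
  rw [Real.exp_zero, sub_zero, smul_eq_mul] at h
  rw [← h]
  ring

theorem quantile_of_shape_eq_zero {θ : Param} (h : shape θ = 0) (z : ℝ) :
    quantile θ z = loc θ + scale θ * z := by
  simp [quantile, h]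

theorem w_quantile {θ : Param} (hτ : 0 < scale θ) (z : ℝ) :
    w θ (quantile θ z) = Real.exp (shape θ * z) := by
  have h := shape_mul_dslope_exp (shape θ) z
  rw [w, quantile, add_sub_cancel_left, mul_div_cancel_left₀ _ hτ.ne', h]
  ring

theorem reduced_quantile {θ : Param} (hτ : 0 < scale θ) (z : ℝ) :
    reduced θ (quantile θ z) = z := by
  by_cases h : shape θ = 0
  · rw [reduced_of_shape_eq_zero h, quantile_of_shape_eq_zero h]
    field_simp
    ring
  · apply mul_left_cancel₀ h
    rw [shape_mul_reduced, w_quantile hτ, Real.log_exp]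

theorem gevCDF_quantile {θ : Param} (hτ : 0 < scale θ) (z : ℝ) :
    gevCDF θ (quantile θ z) = Real.exp (-Real.exp (-z)) := by
  rw [gevCDF_eq_exp (by rw [w_quantile hτ]; positivity), reduced_quantile hτ]

theorem quantile_reduced {θ : Param} {y : ℝ} (hτ : 0 < scale θ) (hw : 0 < w θ y) :
    quantile θ (reduced θ y) = y := by
  by_cases h : shape θ = 0
  · rw [quantile_of_shape_eq_zero h, reduced_of_shape_eq_zero h]
    field_simp
    ring
  · have h1 := w_quantile hτ (reduced θ y)
    rw [exp_shape_mul_reduced hw, w, w] at h1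
    have h2 := mul_left_cancel₀ h (add_left_cancel h1)
    rw [div_left_inj' hτ.ne'] at h2
    linarith

theorem scale_mul_exp_sub_one {θ : Param} (z : ℝ) :
    scale θ * (Real.exp (shape θ * z) - 1) = shape θ * (quantile θ z - loc θ) := by
  rw [← shape_mul_dslope_exp, quantile]
  ring

theorem strictMono_quantile {θ : Param} (hτ : 0 < scale θ) : StrictMono (quantile θ) := by
  intro a b hab
  have ha := scale_mul_exp_sub_one (θ := θ) a
  have hb := scale_mul_exp_sub_one (θ := θ) b
  rcases lt_trichotomy (shape θ) 0 with h | h | h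
  · have h1 : Real.exp (shape θ * b) < Real.exp (shape θ * a) :=
      Real.exp_lt_exp.2 (mul_lt_mul_of_neg_left hab h)
    nlinarith [mul_lt_mul_of_pos_left h1 hτ]
  · rw [quantile_of_shape_eq_zero h, quantile_of_shape_eq_zero h]
    gcongr
  · have h1 : Real.exp (shape θ * a) < Real.exp (shape θ * b) :=
      Real.exp_lt_exp.2 (mul_lt_mul_of_pos_left hab h)
    nlinarith [mul_lt_mul_of_pos_left h1 hτ]

theorem reduced_le_iff {θ : Param} {y z : ℝ} (hτ : 0 < scale θ) (hw : 0 < w θ y) :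
    reduced θ y ≤ z ↔ y ≤ quantile θ z := by
  conv_rhs => rw [← quantile_reduced hτ hw]
  exact (strictMono_quantile hτ).le_iff_le.symm

/-- The GEV family is identifiable. The quantile functions agree; `q 0 = μ`, the ratio
`(q 1 - μ) / (μ - q (-1))` equals `exp ξ`, and `q 1` then gives `τ`. -/
theorem eq_of_gevCDF_eq {θ θ' : Param} (hτ : 0 < scale θ) (hτ' : 0 < scale θ')
    (h : ∀ y, gevCDF θ y = gevCDF θ' y) : θ = θ' := by
  have hq : ∀ z, quantile θ z = quantile θ' z := by
    intro z
    have h1 : gevCDF θ' (quantile θ z) = Real.exp (-Real.exp (-z)) := by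
      rw [← h, gevCDF_quantile hτ]
    have hw : 0 < w θ' (quantile θ z) := by
      apply w_pos_of_gevCDF_mem_Ioo
      · rw [h1]; positivity
      · rw [h1]; exact Real.exp_lt_one_iff.2 (neg_neg_of_pos (Real.exp_pos _))
    rw [gevCDF_eq_exp hw, Real.exp_eq_exp, neg_inj, Real.exp_eq_exp, neg_inj] at h1
    have h2 := quantile_reduced hτ' hw
    rw [h1] at h2
    exact h2.symm
  have hμ : loc θ = loc θ' := by simpa [quantile] using hq 0
  have ratio : ∀ η : Param, quantile η 1 - loc η
      = Real.exp (shape η) * (loc η - quantile η (-1)) := by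
    intro η
    by_cases h0 : shape η = 0
    · simp [quantile_of_shape_eq_zero h0, h0]
    · apply mul_left_cancel₀ h0
      have e1 := scale_mul_exp_sub_one (θ := η) 1
      have e2 := scale_mul_exp_sub_one (θ := η) (-1)
      rw [mul_one] at e1
      rw [mul_neg_one, Real.exp_neg] at e2
      rw [← e1]
      have e3 : shape η * (loc η - quantile η (-1))
          = scale η * (1 - (Real.exp (shape η))⁻¹) := by linarith
      rw [mul_left_comm, e3]
      have := (Real.exp_pos (shape η)).ne'
      field_simp
  have hpos : 0 < loc θ - quantile θ (-1) := by
    have h1 : quantile θ (-1) < quantile θ 0 := strictMono_quantile hτ (by norm_num)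
    have h2 : quantile θ 0 = loc θ := by simp [quantile]
    linarith
  have hξ : shape θ = shape θ' := by
    have h1 := ratio θ
    have h2 := ratio θ'
    rw [← hq, ← hq, ← hμ, h1] at h2
    exact Real.exp_injective (mul_right_cancel₀ hpos.ne' h2)
  have hs : scale θ = scale θ' := by
    have h1 := hq 1
    have h2 : quantile θ 0 < quantile θ 1 := strictMono_quantile hτ (by norm_num)
    simp only [quantile, ← hμ, ← hξ, zero_mul, mul_zero, add_zero] at h1 h2
    refine mul_right_cancel₀ ?_ (add_left_cancel h1)
    rintro h3
    rw [h3, mul_zero] at h2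
    linarith
  ext i
  fin_cases i
  · exact hs
  · exact hμ
  · exact hξ

/-! ### The density and the law of the observations -/

theorem continuous_w (θ : Param) : Continuous (w θ) := by
  unfold w
  fun_prop

/-- The distribution function is continuous, the end point of the support included. -/
theorem continuous_gevCDF {θ : Param} (hτ : 0 < scale θ) : Continuous (gevCDF θ) := by
  rcases lt_trichotomy (shape θ) 0 with h | h | h
  · have hp : 0 < -1 / shape θ := div_pos_of_neg_of_neg (by norm_num) h
    have e : gevCDF θ = fun y => Real.exp (-(max (w θ y) 0 ^ (-1 / shape θ))) := by
      funext y
      rcases lt_or_ge 0 (w θ y) with hw | hw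
      · simp [gevCDF, h.ne, hw, max_eq_left hw.le]
      · simp [gevCDF, h.ne, hw.not_gt, max_eq_right hw, h.le, Real.zero_rpow hp.ne']
    rw [e]
    exact Real.continuous_exp.comp
      (((continuous_w θ).max continuous_const).rpow_const fun _ => Or.inr hp.le).neg
  · exact continuous_iff_continuousAt.2 fun y =>
      (hasDerivAt_gevCDF θ y hτ (Or.inl h)).continuousAt
  · -- `exp (-w ^ (-1 / ξ))`, extended by `0`, is `exp (-1 / u)` at `u = (max w 0) ^ (1 / ξ)`.
    have hp : 0 < 1 / shape θ := by positivity
    have e : gevCDF θ = fun y => expNegInvGlue (max (w θ y) 0 ^ (1 / shape θ)) := by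
      funext y
      rcases lt_or_ge 0 (w θ y) with hw | hw
      · have h1 : 0 < w θ y ^ (1 / shape θ) := Real.rpow_pos_of_pos hw _
        rw [gevCDF, if_neg h.ne', if_pos hw, max_eq_left hw.le, expNegInvGlue,
          if_neg h1.not_ge, neg_div, Real.rpow_neg hw.le]
      · rw [gevCDF, if_neg h.ne', if_neg hw.not_gt, if_pos h, max_eq_right hw,
          Real.zero_rpow hp.ne', expNegInvGlue.zero]
    rw [e]
    exact (expNegInvGlue.contDiff (n := 0)).continuous.comp
      (((continuous_w θ).max continuous_const).rpow_const fun _ => Or.inr hp.le)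

@[fun_prop]
theorem measurable_gevPDF (θ : Param) : Measurable (gevPDF θ) := by
  have hw : Measurable (w θ) := (continuous_w θ).measurable
  have hs : MeasurableSet {y | 0 < w θ y} := measurableSet_lt measurable_const hw
  unfold gevPDF
  by_cases h : shape θ = 0
  · simp only [h, if_true]
    fun_prop
  · simp only [h, if_false]
    exact Measurable.ite hs (by fun_prop) measurable_const

/-- With `c = 1 + ξ > 0` one has `-c z - exp (-z) ≤ c log c - c ≤ c ^ 2` for all `z`, which bounds
the density uniformly. -/
theorem gevPDF_le {θ : Param} (hτ : 0 < scale θ) (hξ : -1 < shape θ) (y : ℝ) :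
    gevPDF θ y ≤ (scale θ)⁻¹ * Real.exp ((1 + shape θ) ^ 2) := by
  rcases lt_or_ge 0 (w θ y) with hw | hw
  · rw [gevPDF_eq_exp hw]
    gcongr
    set c := 1 + shape θ
    have hc : 0 < c := by simp only [c]; linarith
    have h1 := Real.add_one_le_exp (-reduced θ y - Real.log c)
    rw [Real.exp_sub, Real.exp_log hc, le_div_iff₀ hc] at h1
    have h2 := Real.log_le_sub_one_of_pos hc
    nlinarith
  · rw [gevPDF_eq_zero hw]
    positivity

theorem countable_w_eq_zero {θ : Param} (hτ : 0 < scale θ) : {y | w θ y = 0}.Countable := by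
  refine Set.Subsingleton.countable fun a ha b hb => ?_
  have h : shape θ ≠ 0 := fun h => by simp [w_of_shape_eq_zero h] at ha
  simp only [Set.mem_ofPred_eq] at ha hb
  rw [← hb, w, w] at ha
  have h2 := mul_left_cancel₀ h (add_left_cancel ha)
  rw [div_left_inj' hτ.ne'] at h2
  linarith

theorem hasDerivAt_gevCDF_of_w_ne_zero {θ : Param} {y : ℝ} (hτ : 0 < scale θ) (hw : w θ y ≠ 0) :
    HasDerivAt (gevCDF θ) (gevPDF θ y) y := by
  rcases hw.lt_or_gt with hw | hw
  · have h : shape θ ≠ 0 := fun h => by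
      rw [w_of_shape_eq_zero h] at hw
      linarith
    rw [gevPDF_eq_zero hw.le]
    refine (hasDerivAt_const y (if 0 < shape θ then (0 : ℝ) else 1)).congr_of_eventuallyEq ?_
    filter_upwards [(continuous_w θ).continuousAt.eventually (gt_mem_nhds hw)] with z hz
    rw [gevCDF, if_neg h, if_neg hz.not_gt]
  · exact hasDerivAt_gevCDF θ y hτ (Or.inr hw)

theorem integrableOn_gevPDF {θ : Param} (hτ : 0 < scale θ) (hξ : -1 < shape θ) (a b : ℝ) :
    IntegrableOn (gevPDF θ) (Set.Ioc a b) := by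
  refine Measure.integrableOn_of_bounded (M := (scale θ)⁻¹ * Real.exp ((1 + shape θ) ^ 2))
    (by simp) (measurable_gevPDF θ).aestronglyMeasurable (ae_of_all _ fun y => ?_)
  rw [Real.norm_of_nonneg (gevPDF_nonneg hτ y)]
  exact gevPDF_le hτ hξ y

/-- The GEV distribution with parameter `θ`, as the measure with density `p(· | θ)`. -/
noncomputable def gevMeasure (θ : Param) : Measure ℝ :=
  volume.withDensity fun y => ENNReal.ofReal (gevPDF θ y)

theorem gevMeasure_Ioc {θ : Param} (hτ : 0 < scale θ) (hξ : -1 < shape θ) {a b : ℝ}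
    (hab : a ≤ b) :
    gevMeasure θ (Set.Ioc a b) = ENNReal.ofReal (gevCDF θ b - gevCDF θ a) := by
  have hi := integrableOn_gevPDF hτ hξ a b
  rw [gevMeasure, withDensity_apply _ measurableSet_Ioc,
    ← ofReal_integral_eq_lintegral_ofReal hi (ae_of_all _ (gevPDF_nonneg hτ)),
    ← intervalIntegral.integral_of_le hab,
    integral_eq_of_hasDerivAt_off_countable_of_le (gevCDF θ) (gevPDF θ) hab
      (countable_w_eq_zero hτ) (continuous_gevCDF hτ).continuousOn
      (fun x hx => hasDerivAt_gevCDF_of_w_ne_zero hτ hx.2)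
      ((intervalIntegrable_iff_integrableOn_Ioc_of_le hab).2 hi)]

theorem gevCDF_mono {θ : Param} (hτ : 0 < scale θ) (hξ : -1 < shape θ) :
    Monotone (gevCDF θ) := by
  intro a b hab
  have h := integral_eq_of_hasDerivAt_off_countable_of_le (gevCDF θ) (gevPDF θ) hab
      (countable_w_eq_zero hτ) (continuous_gevCDF hτ).continuousOn
      (fun x hx => hasDerivAt_gevCDF_of_w_ne_zero hτ hx.2)
      ((intervalIntegrable_iff_integrableOn_Ioc_of_le hab).2 (integrableOn_gevPDF hτ hξ a b))
  have h2 := intervalIntegral.integral_nonneg (μ := volume) hab fun y _ => gevPDF_nonneg hτ y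
  linarith

theorem lintegral_gevPDF_le_one {θ : Param} (hτ : 0 < scale θ) (hξ : -1 < shape θ) :
    ∫⁻ y, ENNReal.ofReal (gevPDF θ y) ≤ 1 := by
  have h1 : ∫⁻ y, ENNReal.ofReal (gevPDF θ y) = gevMeasure θ Set.univ := by
    rw [gevMeasure, withDensity_apply _ MeasurableSet.univ, Measure.restrict_univ]
  have hu : (⋃ n : ℕ, Set.Ioc (-(n : ℝ)) n) = Set.univ := by
    refine Set.eq_univ_of_forall fun x => ?_
    obtain ⟨n, hn⟩ := exists_nat_gt |x|
    exact Set.mem_iUnion.2 ⟨n, (abs_lt.1 hn).1, (abs_lt.1 hn).2.le⟩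
  have hm : Monotone fun n : ℕ => Set.Ioc (-(n : ℝ)) n := fun m n hmn =>
    Set.Ioc_subset_Ioc (neg_le_neg (Nat.cast_le.2 hmn)) (Nat.cast_le.2 hmn)
  rw [h1, ← hu]
  refine le_of_tendsto' (tendsto_measure_iUnion_atTop hm) fun n => ?_
  have hn : (0 : ℝ) ≤ n := n.cast_nonneg
  rw [Function.comp_apply, gevMeasure_Ioc hτ hξ (by linarith), ← ENNReal.ofReal_one]
  exact ENNReal.ofReal_le_ofReal
    (by linarith [gevCDF_nonneg θ (-(n : ℝ)), gevCDF_le_one θ n])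

theorem tendsto_exp_neg_exp_neg_atBot :
    Tendsto (fun z : ℝ => Real.exp (-Real.exp (-z))) atBot (𝓝 0) :=
  Real.tendsto_exp_neg_atTop_nhds_zero.comp
    (Real.tendsto_exp_atTop.comp tendsto_neg_atBot_atTop)

/-- Densities that agree almost everywhere have distribution functions that differ by a constant,
which vanishes because distribution functions are nonnegative and take arbitrarily small values. -/
theorem eq_of_gevPDF_ae_eq {θ θ' : Param} (hτ : 0 < scale θ) (hξ : -1 < shape θ)
    (hτ' : 0 < scale θ') (hξ' : -1 < shape θ') (h : gevPDF θ =ᵐ[volume] gevPDF θ') :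
    θ = θ' := by
  have hm : gevMeasure θ = gevMeasure θ' := withDensity_congr_ae <| by
    filter_upwards [h] with y hy
    rw [hy]
  have hsub : ∀ a b, a ≤ b → gevCDF θ b - gevCDF θ a = gevCDF θ' b - gevCDF θ' a := by
    intro a b hab
    have h1 := gevMeasure_Ioc hτ hξ hab
    rw [hm, gevMeasure_Ioc hτ' hξ' hab, ENNReal.ofReal_eq_ofReal_iff
      (sub_nonneg.2 (gevCDF_mono hτ' hξ' hab)) (sub_nonneg.2 (gevCDF_mono hτ hξ hab))] at h1
    exact h1.symm
  have hc : ∀ a b, gevCDF θ b - gevCDF θ' b = gevCDF θ a - gevCDF θ' a := by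
    intro a b
    rcases le_total a b with hab | hab <;> linarith [hsub _ _ hab]
  refine eq_of_gevCDF_eq hτ hτ' fun y => le_antisymm ?_ ?_
  · refine sub_nonpos.1 (ge_of_tendsto' tendsto_exp_neg_exp_neg_atBot fun z => ?_)
    rw [← gevCDF_quantile hτ z, ← hc y (quantile θ z)]
    linarith [gevCDF_nonneg θ' (quantile θ z)]
  · refine sub_nonpos.1 (ge_of_tendsto' tendsto_exp_neg_exp_neg_atBot fun z => ?_)
    rw [← gevCDF_quantile hτ' z, ← neg_sub, ← hc y (quantile θ' z)]
    linarith [gevCDF_nonneg θ (quantile θ' z)]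

section Law

variable {Ω : Type*} [MeasurableSpace Ω] {P : Measure Ω} [IsProbabilityMeasure P]
  {X : Ω → ℝ} {θ : Param}

theorem HasGEVLaw.map_eq (hX : Measurable X) (h : HasGEVLaw X θ P) (hτ : 0 < scale θ)
    (hξ : -1 < shape θ) : P.map X = gevMeasure θ := by
  have : IsProbabilityMeasure (P.map X) := Measure.isProbabilityMeasure_map hX.aemeasurable
  have hI : ∀ y, P.map X (Set.Iic y) = ENNReal.ofReal (gevCDF θ y) := fun y => by
    rw [Measure.map_apply hX measurableSet_Iic, ← h y]
    rfl
  refine Measure.ext_of_Ioc _ _ fun a b hab => ?_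
  rw [gevMeasure_Ioc hτ hξ hab.le, ← Set.Iic_sdiff_Iic,
    measure_sdiff (Set.Iic_subset_Iic.2 hab.le) measurableSet_Iic.nullMeasurableSet
      (measure_ne_top _ _), hI, hI, ENNReal.ofReal_sub _ (gevCDF_nonneg θ a)]

theorem HasGEVLaw.ae_w_pos (hX : Measurable X) (h : HasGEVLaw X θ P) (hτ : 0 < scale θ)
    (hξ : -1 < shape θ) : ∀ᵐ ω ∂P, 0 < w θ (X ω) := by
  have h1 : ∀ᵐ y ∂(gevMeasure θ), 0 < w θ y := by
    rw [gevMeasure, ae_withDensity_iff (by fun_prop)]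
    refine ae_of_all _ fun y hy => ?_
    by_contra hw
    exact hy (by rw [gevPDF_eq_zero (not_lt.1 hw), ENNReal.ofReal_zero])
  rw [← h.map_eq hX hτ hξ] at h1
  exact ae_of_ae_map hX.aemeasurable h1

/-- The upper tail of the reduced variable decays at least exponentially. -/
theorem HasGEVLaw.measure_lt_reduced_le (hX : Measurable X) (h : HasGEVLaw X θ P)
    (hτ : 0 < scale θ) (hξ : -1 < shape θ) (z : ℝ) :
    P {ω | z < reduced θ (X ω)} ≤ ENNReal.ofReal (Real.exp (-z)) := by
  calc P {ω | z < reduced θ (X ω)} ≤ P {ω | X ω ≤ quantile θ z}ᶜ := by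
        refine measure_mono_ae ?_
        filter_upwards [h.ae_w_pos hX hτ hξ] with ω hω hz hle
        exact hz.not_ge ((reduced_le_iff hτ hω).2 hle)
    _ = 1 - ENNReal.ofReal (Real.exp (-Real.exp (-z))) := by
        rw [measure_compl (measurableSet_le hX measurable_const) (measure_ne_top _ _),
          measure_univ, h, gevCDF_quantile hτ]
    _ ≤ _ := by
        rw [← ENNReal.ofReal_one, ← ENNReal.ofReal_sub _ (Real.exp_pos _).le]
        exact ENNReal.ofReal_le_ofReal (by linarith [Real.one_sub_le_exp_neg (Real.exp (-z))])

theorem HasGEVLaw.measure_reduced_le (hX : Measurable X) (h : HasGEVLaw X θ P)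
    (hτ : 0 < scale θ) (hξ : -1 < shape θ) (z : ℝ) :
    P {ω | reduced θ (X ω) ≤ z} ≤ ENNReal.ofReal (Real.exp (-Real.exp (-z))) := by
  rw [← gevCDF_quantile hτ z, ← h]
  refine measure_mono_ae ?_
  filter_upwards [h.ae_w_pos hX hτ hξ] with ω hω hz
  exact (reduced_le_iff hτ hω).1 hz

end Law

/-! ### Continuity in the parameter and moments -/

@[fun_prop]
theorem continuous_scale : Continuous scale := by
  unfold scale
  fun_prop

@[fun_prop]
theorem continuous_loc : Continuous loc := by
  unfold loc
  fun_prop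

@[fun_prop]
theorem continuous_shape : Continuous shape := by
  unfold shape
  fun_prop

theorem isOpen_paramSpace : IsOpen paramSpace :=
  (isOpen_lt continuous_const continuous_scale).inter (isOpen_lt continuous_const continuous_shape)

theorem continuousAt_w {θ : Param} (hτ : 0 < scale θ) (y : ℝ) :
    ContinuousAt (fun θ => w θ y) θ := by
  unfold w
  have h := hτ.ne'
  fun_prop (disch := assumption)

theorem continuousAt_reduced {θ : Param} {y : ℝ} (hτ : 0 < scale θ) (hw : 0 < w θ y) :
    ContinuousAt (fun θ => reduced θ y) θ := by
  have h1 : ContinuousAt (dslope Real.log 1) (w θ y) := by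
    by_cases h : w θ y = 1
    · rw [h]
      exact continuousAt_dslope_same.2 (Real.differentiableAt_log one_ne_zero)
    · exact (continuousAt_dslope_of_ne h).2 (Real.continuousAt_log hw.ne')
  have h2 : ContinuousAt (fun θ => dslope Real.log 1 (w θ y)) θ :=
    ContinuousAt.comp (f := fun θ => w θ y) h1 (continuousAt_w hτ y)
  unfold reduced
  have h := hτ.ne'
  fun_prop (disch := assumption)

theorem continuousAt_gevPDF {θ : Param} {y : ℝ} (hτ : 0 < scale θ) (hw : w θ y ≠ 0) :
    ContinuousAt (fun θ => gevPDF θ y) θ := by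
  have hc := continuousAt_w hτ y
  rcases hw.lt_or_gt with hw | hw
  · refine (continuousAt_const (y := (0 : ℝ))).congr ?_
    filter_upwards [hc.eventually (gt_mem_nhds hw)] with θ' h'
    exact (gevPDF_eq_zero h'.le).symm
  · have hr := continuousAt_reduced hτ hw
    have h := hτ.ne'
    have h1 : ContinuousAt (fun θ => (scale θ)⁻¹ *
        Real.exp (-(1 + shape θ) * reduced θ y - Real.exp (-reduced θ y))) θ := by
      fun_prop (disch := assumption)
    refine h1.congr ?_
    filter_upwards [hc.eventually (lt_mem_nhds hw)] with θ' h'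
    exact (gevPDF_eq_exp h').symm

/-- Densities are bounded, uniformly over a neighbourhood of a given parameter. -/
theorem exists_ball_gevPDF_le {θ : Param} (hθ : θ ∈ paramSpace) :
    ∃ δ > 0, ∃ M : ℝ, ∀ θ' ∈ Metric.ball θ δ, θ' ∈ paramSpace ∧ ∀ y, gevPDF θ' y ≤ M := by
  have h := hθ.1.ne'
  have hc : ContinuousAt (fun θ => (scale θ)⁻¹ * Real.exp ((1 + shape θ) ^ 2)) θ := by
    fun_prop (disch := assumption)
  obtain ⟨δ, hδ, hsub⟩ := Metric.eventually_nhds_iff_ball.1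
    ((hc.eventually (gt_mem_nhds (lt_add_one _))).and (isOpen_paramSpace.mem_nhds hθ))
  refine ⟨δ, hδ, (scale θ)⁻¹ * Real.exp ((1 + shape θ) ^ 2) + 1, fun θ' h' => ⟨(hsub θ' h').2, fun y => ?_⟩⟩
  have h2 := (hsub θ' h').2
  exact (gevPDF_le h2.1 (by linarith [h2.2]) y).trans (hsub θ' h').1.le

theorem measurable_reduced (θ : Param) : Measurable (reduced θ) := by
  by_cases h : shape θ = 0
  · have e : reduced θ = fun y => (y - loc θ) / scale θ :=
      funext (reduced_of_shape_eq_zero h)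
    rw [e]
    fun_prop
  · have e : reduced θ = fun y => Real.log (w θ y) / shape θ := by
      funext y
      rw [← shape_mul_reduced, mul_div_cancel_left₀ _ h]
    rw [e]
    exact (Real.measurable_log.comp (continuous_w θ).measurable).div_const _

/-- A variable whose upper tail is at most `exp (-n)` has exponential moments of order `a < 1`:
`exp (a X)` is at most `1` plus the sum of `exp (a (n + 1))` over the `n` with `n < X`. -/
theorem lintegral_exp_mul_ne_top {Ω : Type*} [MeasurableSpace Ω] {P : Measure Ω}
    [IsProbabilityMeasure P] {X : Ω → ℝ} (hX : Measurable X)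
    (h : ∀ n : ℕ, P {ω | (n : ℝ) < X ω} ≤ ENNReal.ofReal (Real.exp (-n)))
    {a : ℝ} (ha : 0 ≤ a) (ha1 : a < 1) :
    ∫⁻ ω, ENNReal.ofReal (Real.exp (a * X ω)) ∂P ≠ ∞ := by
  have hms : ∀ n : ℕ, MeasurableSet {ω | (n : ℝ) < X ω} := fun n =>
    measurableSet_lt measurable_const hX
  have hle : ∀ ω, ENNReal.ofReal (Real.exp (a * X ω)) ≤ 1 + ∑' n : ℕ,
      {ω | (n : ℝ) < X ω}.indicator
        (fun _ => ENNReal.ofReal (Real.exp (a * (n + 1)))) ω := by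
    intro ω
    rcases le_or_gt (X ω) 0 with h0 | h0
    · refine le_add_right ?_
      rw [← ENNReal.ofReal_one]
      exact ENNReal.ofReal_le_ofReal
        (Real.exp_le_one_iff.2 (mul_nonpos_of_nonneg_of_nonpos ha h0))
    · obtain ⟨n, hn⟩ := Nat.exists_eq_succ_of_ne_zero (Nat.ceil_pos.2 h0).ne'
      have h1 : (n : ℝ) < X ω := Nat.lt_ceil.1 (by omega)
      have h2 : X ω ≤ n + 1 := by
        have := Nat.le_ceil (X ω)
        rw [hn] at this
        exact_mod_cast this
      refine le_add_left (le_trans ?_ (ENNReal.le_tsum n))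
      rw [Set.indicator_of_mem (by exact h1)]
      gcongr
  have hterm : ∀ n : ℕ, ∫⁻ ω, {ω | (n : ℝ) < X ω}.indicator
        (fun _ => ENNReal.ofReal (Real.exp (a * (n + 1)))) ω ∂P
        ≤ ENNReal.ofReal (Real.exp a) * ENNReal.ofReal (Real.exp (-(1 - a))) ^ n := by
    intro n
    rw [lintegral_indicator (hms n), setLIntegral_const]
    refine (mul_le_mul_right (h n) _).trans (le_of_eq ?_)
    rw [← ENNReal.ofReal_mul (Real.exp_pos _).le, ← ENNReal.ofReal_pow (Real.exp_pos _).le,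
      ← ENNReal.ofReal_mul (Real.exp_pos _).le, ← Real.exp_nat_mul, ← Real.exp_add,
      ← Real.exp_add]
    congr 2
    ring
  refine ne_top_of_le_ne_top ?_ (lintegral_mono hle)
  rw [lintegral_add_left measurable_const, lintegral_tsum fun n =>
    (measurable_const.indicator (hms n)).aemeasurable]
  refine ENNReal.add_ne_top.2 ⟨by simp, ne_top_of_le_ne_top ?_ (ENNReal.tsum_le_tsum hterm)⟩
  rw [ENNReal.tsum_mul_left, ENNReal.tsum_geometric]
  refine ENNReal.mul_ne_top ENNReal.ofReal_ne_top (ENNReal.inv_ne_top.2 ?_)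
  refine (tsub_pos_of_lt ?_).ne'
  rw [← ENNReal.ofReal_one]
  exact (ENNReal.ofReal_lt_ofReal_iff one_pos).2 (Real.exp_lt_one_iff.2 (by linarith))

/-- Negative moments of the true density: `p₀ ^ (-s)` is `τ ^ s exp (s (1 + ξ) Z + s T)`, where the
reduced variable `Z` and `T = exp (-Z)` have exponential tails. -/
theorem HasGEVLaw.lintegral_gevPDF_rpow_neg_ne_top {Ω : Type*} [MeasurableSpace Ω]
    {P : Measure Ω} [IsProbabilityMeasure P] {X : Ω → ℝ} {θ : Param} (hX : Measurable X)
    (h : HasGEVLaw X θ P) (hτ : 0 < scale θ) (hξ : -1 < shape θ) {s : ℝ} (hs : 0 < s)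
    (hs1 : s < 1) (hs2 : s * (1 + shape θ) < 1) :
    ∫⁻ y, ENNReal.ofReal (gevPDF θ y ^ (-s)) ∂(gevMeasure θ) ≠ ∞ := by
  have hm : Measurable fun ω => reduced θ (X ω) := (measurable_reduced θ).comp hX
  have hc : 0 < 1 + shape θ := by linarith
  have h1 : ∫⁻ ω, ENNReal.ofReal (Real.exp (s * (1 + shape θ) * reduced θ (X ω))) ∂P ≠ ∞ :=
    lintegral_exp_mul_ne_top hm (fun n => h.measure_lt_reduced_le hX hτ hξ n)
      (by positivity) hs2
  have h2 : ∫⁻ ω, ENNReal.ofReal (Real.exp (s * Real.exp (-reduced θ (X ω)))) ∂P ≠ ∞ := by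
    refine lintegral_exp_mul_ne_top (by fun_prop) (fun n => ?_) hs.le hs1
    rcases n.eq_zero_or_pos with rfl | hn
    · simpa using prob_le_one
    · have hn' : (0 : ℝ) < n := Nat.cast_pos.2 hn
      refine le_trans (measure_mono fun ω hω => ?_)
        ((h.measure_reduced_le hX hτ hξ (-Real.log n)).trans_eq ?_)
      · have h3 : Real.log n < -reduced θ (X ω) := (Real.log_lt_iff_lt_exp hn').2 hω
        change reduced θ (X ω) ≤ -Real.log n
        linarith
      · rw [neg_neg, Real.exp_log hn']
  rw [← h.map_eq hX hτ hξ, lintegral_map (by fun_prop) hX]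
  have hle : ∀ᵐ ω ∂P, ENNReal.ofReal (gevPDF θ (X ω) ^ (-s)) ≤
      ENNReal.ofReal (scale θ ^ s * Real.exp s) *
        ENNReal.ofReal (Real.exp (s * (1 + shape θ) * reduced θ (X ω))) +
      ENNReal.ofReal (scale θ ^ s) *
        ENNReal.ofReal (Real.exp (s * Real.exp (-reduced θ (X ω)))) := by
    filter_upwards [h.ae_w_pos hX hτ hξ] with ω hω
    rw [← ENNReal.ofReal_mul (by positivity), ← ENNReal.ofReal_mul (by positivity),
      ← ENNReal.ofReal_add (by positivity) (by positivity)]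
    refine ENNReal.ofReal_le_ofReal ?_
    rw [gevPDF_eq_exp hω, Real.mul_rpow (by positivity) (by positivity), Real.inv_rpow hτ.le,
      Real.rpow_neg hτ.le, inv_inv, ← Real.exp_mul, mul_assoc, ← Real.exp_add, ← mul_add]
    refine mul_le_mul_of_nonneg_left ?_ (by positivity)
    set z := reduced θ (X ω)
    rcases le_or_gt 0 z with hz | hz
    · refine le_add_of_le_of_nonneg (Real.exp_le_exp.2 ?_) (by positivity)
      have h3 : Real.exp (-z) ≤ 1 := Real.exp_le_one_iff.2 (by linarith)
      nlinarith
    · refine le_add_of_nonneg_of_le (by positivity) (Real.exp_le_exp.2 ?_)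
      have h3 : s * (1 + shape θ) * z ≤ 0 := by
        apply mul_nonpos_of_nonneg_of_nonpos <;> [positivity; exact hz.le]
      linarith
  refine ne_top_of_le_ne_top ?_ (lintegral_mono_ae hle)
  rw [lintegral_add_left (by fun_prop), lintegral_const_mul _ (by fun_prop),
    lintegral_const_mul _ (by fun_prop)]
  finiteness

/-- Distinct parameters have a Hellinger-type affinity less than one: this is the equality case of
the weighted inequality between geometric and arithmetic means, with identifiability. -/
theorem lintegral_rpow_mul_rpow_lt_one {θ θ' : Param} (hτ : 0 < scale θ) (hξ : -1 < shape θ)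
    (hτ' : 0 < scale θ') (hξ' : -1 < shape θ') (hne : θ ≠ θ') {s : ℝ} (hs : 0 < s)
    (hs1 : s < 1) :
    ∫⁻ y, ENNReal.ofReal (gevPDF θ y ^ s * gevPDF θ' y ^ (1 - s)) < 1 := by
  have hs' : 0 < 1 - s := by linarith
  have hp := gevPDF_nonneg (θ := θ) hτ
  have hp' := gevPDF_nonneg (θ := θ') hτ'
  have hle : ∀ y, ENNReal.ofReal (gevPDF θ y ^ s * gevPDF θ' y ^ (1 - s)) ≤
      ENNReal.ofReal (s * gevPDF θ y + (1 - s) * gevPDF θ' y) := fun y =>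
    ENNReal.ofReal_le_ofReal
      (Real.geom_mean_le_arith_mean2_weighted hs.le hs'.le (hp y) (hp' y) (by ring))
  have hg : ∫⁻ y, ENNReal.ofReal (s * gevPDF θ y + (1 - s) * gevPDF θ' y) ≤ 1 := by
    have e : ∀ y, ENNReal.ofReal (s * gevPDF θ y + (1 - s) * gevPDF θ' y)
        = ENNReal.ofReal s * ENNReal.ofReal (gevPDF θ y)
          + ENNReal.ofReal (1 - s) * ENNReal.ofReal (gevPDF θ' y) := fun y => by
      rw [ENNReal.ofReal_add (mul_nonneg hs.le (hp y)) (mul_nonneg hs'.le (hp' y)),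
        ENNReal.ofReal_mul hs.le, ENNReal.ofReal_mul hs'.le]
    simp_rw [e]
    rw [lintegral_add_left (by fun_prop), lintegral_const_mul _ (by fun_prop),
      lintegral_const_mul _ (by fun_prop)]
    calc _ ≤ ENNReal.ofReal s * 1 + ENNReal.ofReal (1 - s) * 1 := by
          gcongr
          · exact lintegral_gevPDF_le_one hτ hξ
          · exact lintegral_gevPDF_le_one hτ' hξ'
      _ = 1 := by
          rw [mul_one, mul_one, ← ENNReal.ofReal_add hs.le hs'.le, add_sub_cancel,
            ENNReal.ofReal_one]
  by_contra hcon
  rw [not_lt] at hcon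
  have hfin : ∫⁻ y, ENNReal.ofReal (gevPDF θ y ^ s * gevPDF θ' y ^ (1 - s)) ≠ ∞ :=
    ne_top_of_le_ne_top ENNReal.one_ne_top ((lintegral_mono hle).trans hg)
  have hae := ae_eq_of_ae_le_of_lintegral_le (ae_of_all _ hle) hfin (by fun_prop)
    (hg.trans hcon)
  refine hne (eq_of_gevPDF_ae_eq hτ hξ hτ' hξ' ?_)
  filter_upwards [hae] with y hy
  have h1 := hp y
  have h2 := hp' y
  rw [ENNReal.ofReal_eq_ofReal_iff (by positivity) (by positivity)] at hy
  have key := (Real.geom_mean_eq_arith_mean_weighted_iff_of_pos Finset.univ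
    ![s, 1 - s] ![gevPDF θ y, gevPDF θ' y] (by simp [Fin.forall_fin_two, hs, hs1])
    (by simp) (by simp [Fin.forall_fin_two, h1, h2])).1 (by simpa using hy)
  exact key 0 (Finset.mem_univ _) 1 (Finset.mem_univ _)

/-! ### Exponential decay of the likelihood away from the true parameter -/

/-- The supremum of the tempered likelihood ratios `(p(y | θ) / p(y | θ₀)) ^ s` over the parameters
`θ` within `ρ` of `θ₁`. It is taken over a countable dense set, so that it is measurable in `y`. -/
noncomputable def supRatio (s : ℝ) (θ₀ θ₁ : Param) (ρ y : ℝ) : ℝ≥0∞ :=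
  ⨆ j : ℕ, ⨆ _ : TopologicalSpace.denseSeq Param j ∈ Metric.ball θ₁ ρ,
    ENNReal.ofReal ((gevPDF (TopologicalSpace.denseSeq Param j) y / gevPDF θ₀ y) ^ s)

theorem measurable_supRatio (s : ℝ) (θ₀ θ₁ : Param) (ρ : ℝ) :
    Measurable (supRatio s θ₀ θ₁ ρ) := by
  refine Measurable.iSup fun j => Measurable.iSup_Prop _ ?_
  fun_prop

theorem continuousAt_ratio_rpow {s : ℝ} (hs : 0 < s) (θ₀ : Param) {θ : Param} {y : ℝ}
    (hτ : 0 < scale θ) (hw : w θ y ≠ 0) :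
    ContinuousAt (fun θ => ENNReal.ofReal ((gevPDF θ y / gevPDF θ₀ y) ^ s)) θ :=
  ENNReal.continuous_ofReal.continuousAt.comp
    (((continuousAt_gevPDF hτ hw).div_const _).rpow_const (Or.inr hs.le))

/-- By continuity of the density on its support, the countable supremum dominates the ratio at
every parameter of the ball. -/
theorem ratio_rpow_le_supRatio {s : ℝ} (hs : 0 < s) (θ₀ : Param) {θ₁ θ : Param} {ρ y : ℝ}
    (hθ : θ ∈ Metric.ball θ₁ ρ) (hτ : 0 < scale θ) (hw : 0 < w θ y) :
    ENNReal.ofReal ((gevPDF θ y / gevPDF θ₀ y) ^ s) ≤ supRatio s θ₀ θ₁ ρ y := by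
  refine le_of_forall_lt fun c hc => ?_
  have h1 := (continuousAt_ratio_rpow hs θ₀ hτ hw.ne').eventually (lt_mem_nhds hc)
  have h2 := h1.and (Metric.isOpen_ball.mem_nhds hθ)
  obtain ⟨_, ⟨j, rfl⟩, h3, h4⟩ :=
    (TopologicalSpace.denseRange_denseSeq Param).inter_nhds_nonempty h2
  exact h3.trans_le (le_iSup₂_of_le j h4 le_rfl)

theorem tendsto_supRatio {s : ℝ} (hs : 0 < s) (θ₀ : Param) {θ₁ : Param} {y : ℝ}
    (hτ : 0 < scale θ₁) (hw : w θ₁ y ≠ 0) {δ : ℝ} (hδ : 0 < δ) :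
    Tendsto (fun k : ℕ => supRatio s θ₀ θ₁ (δ / (k + 1)) y) atTop
      (𝓝 (ENNReal.ofReal ((gevPDF θ₁ y / gevPDF θ₀ y) ^ s))) := by
  refine tendsto_order.2 ⟨fun c hc => Eventually.of_forall fun k => hc.trans_le ?_,
    fun c hc => ?_⟩
  · rcases hw.lt_or_gt with h | h
    · simp [gevPDF_eq_zero h.le, Real.zero_rpow hs.ne']
    · exact ratio_rpow_le_supRatio hs θ₀ (Metric.mem_ball_self (by positivity)) hτ h
  · obtain ⟨b, hb, hbc⟩ := exists_between hc
    obtain ⟨ε, hε, hball⟩ := Metric.eventually_nhds_iff_ball.1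
      ((continuousAt_ratio_rpow hs θ₀ hτ hw).eventually (gt_mem_nhds hb))
    have hlim : Tendsto (fun k : ℕ => δ / ((k : ℝ) + 1)) atTop (𝓝 0) := by
      simpa [div_eq_mul_inv] using
        (tendsto_one_div_add_atTop_nhds_zero_nat (𝕜 := ℝ)).const_mul δ
    filter_upwards [hlim.eventually (gt_mem_nhds hε)] with k hk
    exact (iSup₂_le fun j hj =>
      (hball _ (Metric.ball_subset_ball hk.le hj)).le).trans_lt hbc

/-- Around every parameter other than `θ₀` there is a ball over which the supremum of the tempered
likelihood ratios has expectation less than one. Dominated convergence reduces this to the centre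
of the ball, where the expectation is an affinity of distinct densities. -/
theorem exists_lintegral_supRatio_lt_one {s : ℝ} (hs : 0 < s) (hs1 : s < 1) {θ₀ θ₁ : Param}
    (hθ₀ : θ₀ ∈ paramSpace) (hθ₁ : θ₁ ∈ paramSpace) (hne : θ₁ ≠ θ₀)
    (hmom : ∫⁻ y, ENNReal.ofReal (gevPDF θ₀ y ^ (-s)) ∂(gevMeasure θ₀) ≠ ∞) :
    ∃ ρ > 0, Metric.ball θ₁ ρ ⊆ paramSpace ∧
      ∫⁻ y, supRatio s θ₀ θ₁ ρ y ∂(gevMeasure θ₀) < 1 := by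
  obtain ⟨δ, hδ, M, hM⟩ := exists_ball_gevPDF_le hθ₁
  have hM0 : 0 ≤ M := (gevPDF_nonneg hθ₁.1 0).trans ((hM θ₁ (Metric.mem_ball_self hδ)).2 0)
  have hle : ∀ k : ℕ, δ / ((k : ℝ) + 1) ≤ δ := fun k =>
    div_le_self hδ.le (by linarith [k.cast_nonneg (α := ℝ)])
  have hdom : ∀ (k : ℕ) (y : ℝ), supRatio s θ₀ θ₁ (δ / (k + 1)) y ≤
      ENNReal.ofReal (M ^ s) * ENNReal.ofReal (gevPDF θ₀ y ^ (-s)) := by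
    intro k y
    refine iSup₂_le fun j hj => ?_
    obtain ⟨h1, h2⟩ := hM _ (Metric.ball_subset_ball (hle k) hj)
    have h3 := gevPDF_nonneg (θ := θ₀) hθ₀.1 y
    have h4 := gevPDF_nonneg h1.1 y
    rw [← ENNReal.ofReal_mul (by positivity), Real.div_rpow h4 h3, Real.rpow_neg h3,
      div_eq_mul_inv]
    gcongr
    exact h2 y
  have hlim := tendsto_lintegral_of_dominated_convergence _
    (fun k : ℕ => measurable_supRatio s θ₀ θ₁ (δ / (k + 1)))
    (fun k => ae_of_all (gevMeasure θ₀) (hdom k))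
    (by rw [lintegral_const_mul _ (by fun_prop)]
        exact ENNReal.mul_ne_top ENNReal.ofReal_ne_top hmom)
    (f := fun y => ENNReal.ofReal ((gevPDF θ₁ y / gevPDF θ₀ y) ^ s)) (by
      refine (withDensity_absolutelyContinuous _ _).ae_le ?_
      filter_upwards [(countable_w_eq_zero hθ₁.1).ae_notMem volume] with y hy
      exact tendsto_supRatio hs θ₀ hθ₁.1 hy hδ)
  have hlt : ∫⁻ y, ENNReal.ofReal ((gevPDF θ₁ y / gevPDF θ₀ y) ^ s) ∂(gevMeasure θ₀) < 1 := by
    refine lt_of_le_of_lt ?_ (lintegral_rpow_mul_rpow_lt_one hθ₁.1 (by linarith [hθ₁.2])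
      hθ₀.1 (by linarith [hθ₀.2]) hne hs hs1)
    rw [gevMeasure, lintegral_withDensity_eq_lintegral_mul _ (by fun_prop) (by fun_prop)]
    refine lintegral_mono fun y => ?_
    have h3 := gevPDF_nonneg (θ := θ₀) hθ₀.1 y
    have h4 := gevPDF_nonneg (θ := θ₁) hθ₁.1 y
    rw [Pi.mul_apply, ← ENNReal.ofReal_mul h3]
    refine ENNReal.ofReal_le_ofReal ?_
    rcases h3.eq_or_lt with h0 | h0
    · rw [← h0]
      simp [Real.zero_rpow (sub_ne_zero.2 hs1.ne')]
    · rw [Real.div_rpow h4 h3, Real.rpow_sub h0, Real.rpow_one]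
      exact le_of_eq (by ring)
  obtain ⟨k, hk⟩ := (hlim.eventually (gt_mem_nhds hlt)).exists
  exact ⟨δ / (k + 1), by positivity,
    fun θ hθ => (hM θ (Metric.ball_subset_ball (hle k) hθ)).1, hk⟩

section Independent

variable {Ω : Type*} [MeasurableSpace Ω] {P : Measure Ω} {Y : ℕ → Ω → ℝ}

/-- A product of independent nonnegative factors whose expectations are at most `a < 1` decays
geometrically, almost surely. -/
theorem exists_ae_eventually_prod_lt (hmeas : ∀ i, Measurable (Y i)) (hindep : iIndepFun Y P)
    {g : ℝ → ℝ≥0∞} (hg : Measurable g) {a : ℝ≥0∞} (ha : a < 1)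
    (hga : ∀ i, ∫⁻ ω, g (Y i ω) ∂P ≤ a) :
    ∃ κ : ℝ, 0 < κ ∧ κ < 1 ∧ ∀ᵐ ω ∂P, ∀ᶠ n in atTop,
      ∏ i ∈ Finset.range n, g (Y i ω) < ENNReal.ofReal (κ ^ n) := by
  obtain ⟨b, hab, hb1⟩ := exists_between ha
  have hb0 : b ≠ 0 := (bot_le.trans_lt hab).ne'
  have hbt : b ≠ ∞ := (hb1.trans ENNReal.one_lt_top).ne
  have hprod : ∀ n, ∫⁻ ω, ∏ i ∈ Finset.range n, g (Y i ω) ∂P ≤ a ^ n := by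
    intro n
    rw [lintegral_prod_eq_prod_lintegral_of_indepFun (Finset.range n) (fun i ω => g (Y i ω))
      (hindep.comp (fun _ => g) fun _ => hg) fun i => hg.comp (hmeas i)]
    simpa using Finset.prod_le_pow_card (Finset.range n) _ a fun i _ => hga i
  have hmk : ∀ n, P {ω | b ^ n ≤ ∏ i ∈ Finset.range n, g (Y i ω)} ≤ (a / b) ^ n := by
    intro n
    refine (meas_ge_le_lintegral_div ?_ (pow_ne_zero n hb0) (ENNReal.pow_ne_top hbt)).trans ?_
    · exact (Finset.measurable_fun_prod _ fun i _ => hg.comp (hmeas i)).aemeasurable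
    · rw [div_eq_mul_inv a, mul_pow, ← ENNReal.inv_pow, ← div_eq_mul_inv]
      exact ENNReal.div_le_div_right (hprod n) _
  have hsum : ∑' n, P {ω | b ^ n ≤ ∏ i ∈ Finset.range n, g (Y i ω)} ≠ ∞ := by
    refine ne_top_of_le_ne_top ?_ (ENNReal.tsum_le_tsum hmk)
    rw [ENNReal.tsum_geometric]
    refine ENNReal.inv_ne_top.2 (tsub_pos_of_lt ?_).ne'
    exact ENNReal.div_lt_of_lt_mul (by rwa [one_mul])
  refine ⟨b.toReal, ENNReal.toReal_pos hb0 hbt, ?_, ?_⟩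
  · rw [← ENNReal.toReal_one]
    exact (ENNReal.toReal_lt_toReal hbt ENNReal.one_ne_top).2 hb1
  · filter_upwards [ae_eventually_notMem hsum] with ω hω
    filter_upwards [hω] with n hn
    rw [ENNReal.ofReal_pow ENNReal.toReal_nonneg, ENNReal.ofReal_toReal hbt]
    exact not_le.1 hn

/-- Likelihood ratios decay exponentially, uniformly near any parameter other than `θ₀`. -/
theorem exists_ball_likelihood_le [IsProbabilityMeasure P] {θ₀ θ₁ : Param} (hθ₀ : θ₀ ∈ paramSpace)
    (hθ₁ : θ₁ ∈ paramSpace) (hne : θ₁ ≠ θ₀) (hmeas : ∀ i, Measurable (Y i))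
    (hindep : iIndepFun Y P) (hlaw : ∀ i, HasGEVLaw (Y i) θ₀ P) :
    ∃ ρ > 0, ∃ c > 0, ∀ᵐ ω ∂P, ∀ᶠ n : ℕ in atTop, ∀ θ ∈ Metric.ball θ₁ ρ,
      ∏ i ∈ Finset.range n, gevPDF θ (Y i ω) ≤
        Real.exp (-(c * n)) * ∏ i ∈ Finset.range n, gevPDF θ₀ (Y i ω) := by
  have hξ₀ : -1 < shape θ₀ := by linarith [hθ₀.2]
  -- Any exponent `s` with `s < 1` and `s * (1 + ξ₀) < 1` gives a finite moment of `p₀ ^ (-s)`.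
  have hd : 0 < 2 + shape θ₀ := by linarith
  obtain ⟨s, hs, hs1, hs2⟩ : ∃ s : ℝ, 0 < s ∧ s < 1 ∧ s * (1 + shape θ₀) < 1 := by
    refine ⟨1 / (2 + shape θ₀), by positivity, ?_, ?_⟩
    · rw [div_lt_one hd]
      linarith
    · rw [div_mul_eq_mul_div, div_lt_one hd]
      linarith
  obtain ⟨ρ, hρ, hsub, hlt⟩ := exists_lintegral_supRatio_lt_one hs hs1 hθ₀ hθ₁ hne
    ((hlaw 0).lintegral_gevPDF_rpow_neg_ne_top (hmeas 0) hθ₀.1 hξ₀ hs hs1 hs2)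
  obtain ⟨κ, hκ0, hκ1, hκ⟩ := exists_ae_eventually_prod_lt hmeas hindep
    (measurable_supRatio s θ₀ θ₁ ρ) hlt fun i => by
      rw [← (hlaw i).map_eq (hmeas i) hθ₀.1 hξ₀,
        lintegral_map (measurable_supRatio s θ₀ θ₁ ρ) (hmeas i)]
  refine ⟨ρ, hρ, -Real.log κ / s, div_pos (neg_pos.2 (Real.log_neg hκ0 hκ1)) hs, ?_⟩
  have hw := ae_all_iff.2 fun i => (hlaw i).ae_w_pos (hmeas i) hθ₀.1 hξ₀
  filter_upwards [hκ, hw] with ω hω hwω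
  filter_upwards [hω] with n hn θ hθ
  have hp₀ : 0 < ∏ i ∈ Finset.range n, gevPDF θ₀ (Y i ω) :=
    Finset.prod_pos fun i _ => gevPDF_pos hθ₀.1 (hwω i)
  by_cases hpos : ∀ i ∈ Finset.range n, 0 < w θ (Y i ω)
  · have h1 : ENNReal.ofReal (∏ i ∈ Finset.range n,
        (gevPDF θ (Y i ω) / gevPDF θ₀ (Y i ω)) ^ s) < ENNReal.ofReal (κ ^ n) := by
      refine lt_of_le_of_lt ?_ hn
      rw [ENNReal.ofReal_prod_of_nonneg fun i _ => Real.rpow_nonneg (div_nonneg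
        (gevPDF_nonneg (hsub hθ).1 _) (gevPDF_nonneg hθ₀.1 _)) _]
      exact Finset.prod_le_prod' fun i hi =>
        ratio_rpow_le_supRatio hs θ₀ hθ (hsub hθ).1 (hpos i hi)
    have h2 := (ENNReal.ofReal_lt_ofReal_iff (pow_pos hκ0 n)).1 h1
    rw [Real.finsetProd_rpow _ _ (fun i _ => div_nonneg
        (gevPDF_nonneg (hsub hθ).1 _) (gevPDF_nonneg hθ₀.1 _)), Finset.prod_div_distrib] at h2
    have h3 : κ ^ n = Real.exp (-(-Real.log κ / s * n)) ^ s := by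
      rw [← Real.exp_mul, ← Real.rpow_natCast, Real.rpow_def_of_pos hκ0]
      congr 1
      field_simp
    rw [h3, Real.rpow_lt_rpow_iff (div_nonneg
      (Finset.prod_nonneg fun i _ => gevPDF_nonneg (hsub hθ).1 _) hp₀.le)
      (Real.exp_pos _).le hs, div_lt_iff₀ hp₀] at h2
    exact h2.le
  · push Not at hpos
    obtain ⟨i, hi, hwi⟩ := hpos
    rw [Finset.prod_eq_zero hi (gevPDF_eq_zero hwi)]
    positivity

/-- Likelihood ratios decay exponentially, uniformly over a compact set that avoids `θ₀`. -/
theorem exists_likelihood_le_of_isCompact [IsProbabilityMeasure P] {θ₀ : Param}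
    (hθ₀ : θ₀ ∈ paramSpace)
    {L : Set Param} (hL : IsCompact L) (hLsub : L ⊆ paramSpace) (hL₀ : θ₀ ∉ L)
    (hmeas : ∀ i, Measurable (Y i)) (hindep : iIndepFun Y P)
    (hlaw : ∀ i, HasGEVLaw (Y i) θ₀ P) :
    ∃ c > 0, ∀ᵐ ω ∂P, ∀ᶠ n : ℕ in atTop, ∀ θ ∈ L,
      ∏ i ∈ Finset.range n, gevPDF θ (Y i ω) ≤
        Real.exp (-(c * n)) * ∏ i ∈ Finset.range n, gevPDF θ₀ (Y i ω) := by
  refine hL.induction_on (p := fun S => ∃ c > 0, ∀ᵐ ω ∂P, ∀ᶠ n : ℕ in atTop, ∀ θ ∈ S,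
      ∏ i ∈ Finset.range n, gevPDF θ (Y i ω) ≤
        Real.exp (-(c * n)) * ∏ i ∈ Finset.range n, gevPDF θ₀ (Y i ω)) ?_ ?_ ?_ ?_
  · exact ⟨1, one_pos, by simp⟩
  · rintro S T hST ⟨c, hc, h⟩
    refine ⟨c, hc, ?_⟩
    filter_upwards [h] with ω hω
    filter_upwards [hω] with n hn θ hθ
    exact hn θ (hST hθ)
  · rintro S T ⟨c, hc, h⟩ ⟨d, hd, h'⟩
    refine ⟨min c d, lt_min hc hd, ?_⟩
    filter_upwards [h, h'] with ω hω hω'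
    filter_upwards [hω, hω'] with n hn hn' θ hθ
    have hp₀ : 0 ≤ ∏ i ∈ Finset.range n, gevPDF θ₀ (Y i ω) :=
      Finset.prod_nonneg fun i _ => gevPDF_nonneg hθ₀.1 _
    rcases hθ with hθ | hθ
    · refine (hn θ hθ).trans ?_
      gcongr
      exact min_le_left c d
    · refine (hn' θ hθ).trans ?_
      gcongr
      exact min_le_right c d
  · intro θ hθ
    obtain ⟨ρ, hρ, c, hc, h⟩ := exists_ball_likelihood_le hθ₀ (hLsub hθ)
      (fun h => hL₀ (h ▸ hθ)) hmeas hindep hlaw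
    exact ⟨Metric.ball θ ρ, mem_nhdsWithin_of_mem_nhds (Metric.ball_mem_nhds θ hρ), c, hc, h⟩

end Independent

/-! ### Stability of the density at the true parameter -/

theorem dslope_log_eq_integral {v : ℝ} (hv : 0 < v) :
    dslope Real.log 1 v = ∫ t in (0 : ℝ)..1, (1 + t * (v - 1))⁻¹ := by
  by_cases h1 : v = 1
  · simp [h1]
  · have hpos : ∀ t ∈ Set.uIcc (0 : ℝ) 1, 0 < 1 + t * (v - 1) := by
      intro t ht
      rw [Set.uIcc_of_le zero_le_one] at ht
      rcases ht.2.eq_or_lt with rfl | h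
      · linarith
      · nlinarith [mul_nonneg ht.1 hv.le]
    have hc : ContinuousOn (fun t : ℝ => (1 + t * (v - 1))⁻¹) (Set.uIcc 0 1) :=
      ContinuousOn.inv₀ (by fun_prop) fun t ht => (hpos t ht).ne'
    have hd : ∀ t ∈ Set.uIcc (0 : ℝ) 1, HasDerivAt (fun t => Real.log (1 + t * (v - 1)))
        ((v - 1) * (1 + t * (v - 1))⁻¹) t := by
      intro t ht
      have h2 : HasDerivAt (fun t : ℝ => 1 + t * (v - 1)) (1 * (v - 1)) t :=
        ((hasDerivAt_id t).mul_const (v - 1)).const_add 1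
      simpa [div_eq_mul_inv] using h2.log (hpos t ht).ne'
    have h3 := intervalIntegral.integral_eq_sub_of_hasDerivAt hd
      (hc.const_mul (v - 1)).intervalIntegrable
    have h4 := sub_smul_dslope Real.log 1 v
    apply mul_left_cancel₀ (sub_ne_zero.2 h1)
    rw [← intervalIntegral.integral_const_mul, h3, ← smul_eq_mul, h4]
    simp

theorem le_one_add_mul_sub_one {m u t : ℝ} (hm1 : m ≤ 1) (hu : m ≤ u) (h0 : 0 ≤ t)
    (h1 : t ≤ 1) : m ≤ 1 + t * (u - 1) := by
  nlinarith [mul_le_mul_of_nonneg_left hu h0,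
    mul_le_mul_of_nonneg_left hm1 (sub_nonneg.2 h1)]

theorem abs_dslope_log_le {m u : ℝ} (hm : 0 < m) (hm1 : m ≤ 1) (hu : m ≤ u) :
    |dslope Real.log 1 u| ≤ m⁻¹ := by
  rw [dslope_log_eq_integral (hm.trans_le hu), ← Real.norm_eq_abs]
  refine (intervalIntegral.norm_integral_le_of_norm_le_const (C := m⁻¹) fun t ht => ?_).trans_eq
    (by simp)
  rw [Set.uIoc_of_le zero_le_one] at ht
  have h := le_one_add_mul_sub_one hm1 hu ht.1.le ht.2
  rw [Real.norm_of_nonneg (inv_nonneg.2 (hm.le.trans h))]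
  exact inv_anti₀ hm h

theorem abs_dslope_log_sub_le {m u v : ℝ} (hm : 0 < m) (hm1 : m ≤ 1) (hu : m ≤ u)
    (hv : m ≤ v) : |dslope Real.log 1 u - dslope Real.log 1 v| ≤ |u - v| * (m ^ 2)⁻¹ := by
  have hi : ∀ u, m ≤ u →
      IntervalIntegrable (fun t : ℝ => (1 + t * (u - 1))⁻¹) volume 0 1 := by
    intro u hu
    refine (ContinuousOn.inv₀ (by fun_prop) fun t ht => ?_).intervalIntegrable
    rw [Set.uIcc_of_le zero_le_one] at ht
    exact (hm.trans_le (le_one_add_mul_sub_one hm1 hu ht.1 ht.2)).ne'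
  rw [dslope_log_eq_integral (hm.trans_le hu), dslope_log_eq_integral (hm.trans_le hv),
    ← intervalIntegral.integral_sub (hi u hu) (hi v hv), ← Real.norm_eq_abs]
  refine (intervalIntegral.norm_integral_le_of_norm_le_const (C := |u - v| * (m ^ 2)⁻¹)
    fun t ht => ?_).trans_eq (by simp)
  rw [Set.uIoc_of_le zero_le_one] at ht
  have ha := le_one_add_mul_sub_one hm1 hu ht.1.le ht.2
  have hb := le_one_add_mul_sub_one hm1 hv ht.1.le ht.2
  have ha0 := hm.trans_le ha
  have hb0 := hm.trans_le hb
  have e : (1 + t * (u - 1))⁻¹ - (1 + t * (v - 1))⁻¹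
      = t * (v - u) * ((1 + t * (u - 1)) * (1 + t * (v - 1)))⁻¹ := by
    field_simp
    ring
  rw [e, norm_mul, norm_mul, Real.norm_of_nonneg ht.1.le, Real.norm_eq_abs, abs_sub_comm,
    Real.norm_of_nonneg (inv_nonneg.2 (mul_nonneg ha0.le hb0.le)), sq]
  gcongr
  exact mul_le_of_le_one_left (abs_nonneg _) ht.2

theorem abs_exp_sub_one_le_mul_exp (x : ℝ) : |Real.exp x - 1| ≤ |x| * Real.exp |x| := by
  rcases le_total 0 x with h | h
  · rw [abs_of_nonneg h, abs_of_nonneg (by linarith [Real.add_one_le_exp x])]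
    have h1 := Real.add_one_le_exp (-x)
    have h2 : Real.exp (-x) * Real.exp x = 1 := by rw [← Real.exp_add]; simp
    nlinarith [Real.exp_pos x]
  · rw [abs_of_nonpos h, abs_of_nonpos (by linarith [Real.exp_le_one_iff.2 h])]
    have h1 := Real.add_one_le_exp x
    have h2 : 1 ≤ Real.exp (-x) := Real.one_le_exp (by linarith)
    nlinarith

/-- The standardized observation grows at most exponentially in the reduced variable. -/
theorem abs_standardized_le {θ : Param} {y : ℝ} (hw : 0 < w θ y) :
    |(y - loc θ) / scale θ| ≤ Real.exp ((|shape θ| + 1) * |reduced θ y|) := by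
  set z := reduced θ y
  have h1 : |(y - loc θ) / scale θ| ≤ |z| * Real.exp |shape θ * z| := by
    by_cases h : shape θ = 0
    · simp [z, reduced_of_shape_eq_zero h, h]
    · have h2 := abs_exp_sub_one_le_mul_exp (shape θ * z)
      rw [exp_shape_mul_reduced hw, w, add_sub_cancel_left, abs_mul,
        show |shape θ * z| * Real.exp |shape θ * z|
          = |shape θ| * (|z| * Real.exp |shape θ * z|) by rw [abs_mul]; ring] at h2
      exact le_of_mul_le_mul_left h2 (abs_pos.2 h)
  refine h1.trans ?_
  rw [add_mul, one_mul, add_comm, Real.exp_add, abs_mul]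
  gcongr
  linarith [Real.add_one_le_exp |z|]

theorem abs_coord_sub_le (θ θ' : Param) (i : Fin 3) : |θ i - θ' i| ≤ ‖θ - θ'‖ := by
  simpa using PiLp.norm_apply_le (θ - θ') i

/-- Perturbation bound for the reduced variable, for parameters whose coordinates differ by at most
`d` from those of `θ₀`; `L` controls the size of the observation and its distance to the end point
of the support. -/
theorem abs_reduced_sub_le {θ₀ θ : Param} {y d L k h C₁ : ℝ} (hτ₀ : 0 < scale θ₀)
    (hh : h = 2 / scale θ₀) (hC₁ : C₁ = 2 * h * k + 1)
    (hs : |scale θ - scale θ₀| ≤ d) (hl : |loc θ - loc θ₀| ≤ d)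
    (hsh : |shape θ - shape θ₀| ≤ d) (hd : d ≤ scale θ₀ / 2) (hsha : |shape θ| ≤ k)
    (hL1 : 1 ≤ L) (hx₀ : |(y - loc θ₀) / scale θ₀| ≤ L) (hw : L⁻¹ ≤ w θ₀ y)
    (hdw : C₁ * d * L ≤ (2 * L)⁻¹) :
    0 < w θ y ∧ |reduced θ y - reduced θ₀ y| ≤ (4 * h + 4 * C₁) * d * L ^ 4 := by
  have hL0 : 0 < L := by linarith
  have hd0 : 0 ≤ d := (abs_nonneg _).trans hs
  have hk0 : 0 ≤ k := (abs_nonneg _).trans hsha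
  have hh0 : 0 < h := by rw [hh]; positivity
  have hC₁0 : 0 < C₁ := by rw [hC₁]; positivity
  have hτge : scale θ₀ / 2 ≤ scale θ := by linarith [(abs_le.1 hs).1]
  have hτ : 0 < scale θ := by linarith
  set x₀ := (y - loc θ₀) / scale θ₀ with hx₀'
  set x := (y - loc θ) / scale θ with hx'
  have hxx : |x - x₀| ≤ 2 * h * d * L := by
    have e : x - x₀ = ((scale θ₀ - scale θ) * x₀ + (loc θ₀ - loc θ)) / scale θ := by
      rw [hx', hx₀']
      field_simp
      ring
    rw [e, abs_div, abs_of_pos hτ, div_le_iff₀ hτ]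
    have h1 : |(scale θ₀ - scale θ) * x₀ + (loc θ₀ - loc θ)| ≤ d * L + d * L := by
      refine (abs_add_le _ _).trans (add_le_add ?_ ?_)
      · rw [abs_mul, abs_sub_comm]
        gcongr
      · rw [abs_sub_comm]
        nlinarith
    have h2 : 1 ≤ h * scale θ := by
      rw [hh, div_mul_eq_mul_div, le_div_iff₀ hτ₀]
      linarith
    calc _ ≤ 2 * d * L * 1 := by linarith
      _ ≤ 2 * d * L * (h * scale θ) := by gcongr
      _ = _ := by ring
  have hww : |w θ y - w θ₀ y| ≤ C₁ * d * L := by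
    have e : w θ y - w θ₀ y = shape θ * (x - x₀) + (shape θ - shape θ₀) * x₀ := by
      rw [w, w]
      ring
    rw [e]
    calc _ ≤ |shape θ| * |x - x₀| + |shape θ - shape θ₀| * |x₀| := by
          rw [← abs_mul, ← abs_mul]
          exact abs_add_le _ _
      _ ≤ k * (2 * h * d * L) + d * L := by gcongr
      _ = C₁ * d * L := by rw [hC₁]; ring
  set m := (2 * L)⁻¹ with hm
  have hm0 : 0 < m := by positivity
  have hm1 : m ≤ 1 := inv_le_one_of_one_le₀ (by linarith)
  have hLm : L⁻¹ = m + m := by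
    rw [hm, mul_inv]
    ring
  have hmw₀ : m ≤ w θ₀ y := by linarith
  have hmw : m ≤ w θ y := by linarith [(abs_le.1 hww).1]
  have hwθ : 0 < w θ y := hm0.trans_le hmw
  refine ⟨hwθ, ?_⟩
  have e : reduced θ y - reduced θ₀ y = (x - x₀) * dslope Real.log 1 (w θ y)
      + x₀ * (dslope Real.log 1 (w θ y) - dslope Real.log 1 (w θ₀ y)) := by
    rw [reduced, reduced]
    ring
  rw [e]
  calc _ ≤ |x - x₀| * |dslope Real.log 1 (w θ y)|
        + |x₀| * |dslope Real.log 1 (w θ y) - dslope Real.log 1 (w θ₀ y)| := by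
        rw [← abs_mul, ← abs_mul]
        exact abs_add_le _ _
    _ ≤ (2 * h * d * L) * m⁻¹ + L * (|w θ y - w θ₀ y| * (m ^ 2)⁻¹) := by
        gcongr
        · exact abs_dslope_log_le hm0 hm1 hmw
        · exact abs_dslope_log_sub_le hm0 hm1 hmw hmw₀
    _ ≤ (2 * h * d * L) * m⁻¹ + L * (C₁ * d * L * (m ^ 2)⁻¹) := by gcongr
    _ = 4 * h * d * L ^ 2 + 4 * C₁ * d * L ^ 4 := by
        rw [← inv_pow, hm, inv_inv]
        ring
    _ ≤ 4 * h * d * L ^ 4 + 4 * C₁ * d * L ^ 4 := by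
        gcongr
        norm_num
    _ = (4 * h + 4 * C₁) * d * L ^ 4 := by ring

/-- Stability of the density at the true parameter: a perturbation of size `d` lowers the
log-density by at most `C d exp (b |z|)`, where `z` is the reduced variable of the observation. -/
theorem exists_exp_neg_mul_gevPDF_le {θ₀ : Param} (hθ₀ : θ₀ ∈ paramSpace) :
    ∃ C > 0, ∃ b > 0, ∀ (θ : Param) (y ε : ℝ), 0 < w θ₀ y → ε ≤ 1 →
      C * ‖θ - θ₀‖ * Real.exp (b * |reduced θ₀ y|) ≤ ε →
      Real.exp (-ε) * gevPDF θ₀ y ≤ gevPDF θ y := by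
  set a := |shape θ₀| with ha
  have ha0 : 0 ≤ a := abs_nonneg _
  have hτ₀ := hθ₀.1
  set h := 2 / scale θ₀ with hh
  have hh0 : 0 < h := by positivity
  set C₁ := 2 * h * (a + 1) + 1 with hC₁
  have hC₁0 : 0 < C₁ := by positivity
  set C₂ := 4 * h + 4 * C₁ with hC₂
  have hC₂0 : 0 < C₂ := by positivity
  set C₃ := h + (a + 2) * C₂ + 1 + 2 * C₂ with hC₃
  refine ⟨C₃, by positivity, 5 * (a + 1), by positivity, fun θ y ε hw hε1 hε => ?_⟩
  set z₀ := reduced θ₀ y with hz₀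
  set d := ‖θ - θ₀‖ with hd
  have hd0 : 0 ≤ d := norm_nonneg _
  set L := Real.exp ((a + 1) * |z₀|) with hL
  have hL1 : 1 ≤ L := Real.one_le_exp (by positivity)
  have hL0 : 0 < L := by linarith
  have hL5 : Real.exp (5 * (a + 1) * |z₀|) = L ^ 5 := by
    rw [hL, ← Real.exp_nat_mul, mul_assoc]
    norm_cast
  rw [hL5] at hε
  -- All the smallness conditions needed below follow from `C₃ * d * L ^ 5 ≤ ε ≤ 1`.
  have small : ∀ k ≤ 5, ∀ c ≤ C₃, 0 ≤ c → c * d * L ^ k ≤ 1 := fun k hk c hc hc0 =>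
    le_trans (by gcongr) (hε.trans hε1)
  have hp1 : 0 ≤ (a + 2) * C₂ := by positivity
  have hd1 : d ≤ 1 := by
    have := small 0 (by norm_num) 1 (by linarith) zero_le_one
    simpa using this
  have hdτ : h * d ≤ 1 := by
    have := small 0 (by norm_num) h (by linarith) hh0.le
    simpa using this
  have hdw : C₁ * d * L ≤ (2 * L)⁻¹ := by
    have := small 2 (by norm_num) (2 * C₁) (by linarith) (by positivity)
    rw [← one_div, le_div_iff₀ (by positivity)]
    linarith
  have hx₀ : |(y - loc θ₀) / scale θ₀| ≤ L := abs_standardized_le hw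
  have hzle : |z₀| ≤ L := by
    have h1 := Real.add_one_le_exp ((a + 1) * |z₀|)
    nlinarith [mul_nonneg ha0 (abs_nonneg z₀)]
  have hTle : Real.exp (-z₀) ≤ L := by
    refine Real.exp_le_exp.2 ?_
    nlinarith [mul_nonneg ha0 (abs_nonneg z₀), neg_abs_le z₀]
  have hwge : L⁻¹ ≤ w θ₀ y := by
    rw [← exp_shape_mul_reduced hw, hL, ← Real.exp_neg]
    refine Real.exp_le_exp.2 ?_
    have h1 := neg_abs_le (shape θ₀ * z₀)
    rw [abs_mul] at h1
    linarith [abs_nonneg z₀]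
  have hs : |scale θ - scale θ₀| ≤ d := abs_coord_sub_le θ θ₀ 0
  have hl : |loc θ - loc θ₀| ≤ d := abs_coord_sub_le θ θ₀ 1
  have hsh : |shape θ - shape θ₀| ≤ d := abs_coord_sub_le θ θ₀ 2
  have hd2 : d ≤ scale θ₀ / 2 := by
    rw [hh, div_mul_eq_mul_div, div_le_one hτ₀] at hdτ
    linarith
  have hτge : scale θ₀ / 2 ≤ scale θ := by linarith [(abs_le.1 hs).1]
  have hτ : 0 < scale θ := by linarith
  have hsha : |shape θ| ≤ a + 1 := by
    have := abs_sub_abs_le_abs_sub (shape θ) (shape θ₀)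
    linarith
  obtain ⟨hwθ, hzz⟩ := abs_reduced_sub_le hτ₀ hh hC₁ hs hl hsh hd2 hsha hL1 hx₀ hwge hdw
  rw [← hC₂] at hzz
  set D := C₂ * d * L ^ 4 with hD
  have hD0 : 0 ≤ D := by positivity
  have hD1 : D ≤ 1 := small 4 (by norm_num) C₂ (by linarith) hC₂0.le
  have hDL : D ≤ C₂ * d * L ^ 5 := by
    rw [hD]
    gcongr
    norm_num
  have hdL : d * L ≤ d * L ^ 5 := by
    gcongr
    exact le_self_pow₀ hL1 (by norm_num)
  have hdL' : d ≤ d * L ^ 5 := le_mul_of_one_le_right hd0 (one_le_pow₀ hL1)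
  -- The logarithm of the density ratio is the sum of three differences, each `O(d * L ^ 5)`.
  have t1 : Real.log (scale θ) - Real.log (scale θ₀) ≤ h * (d * L ^ 5) := by
    rw [← Real.log_div hτ.ne' hτ₀.ne']
    have h1 := Real.log_le_sub_one_of_pos (div_pos hτ hτ₀)
    have h2 : scale θ / scale θ₀ - 1 ≤ h * d := by
      rw [hh, div_sub_one hτ₀.ne', div_mul_eq_mul_div]
      gcongr
      linarith [(abs_le.1 hs).2]
    have h3 : h * d ≤ h * (d * L ^ 5) := by gcongr
    linarith
  have t2 : (1 + shape θ) * reduced θ y - (1 + shape θ₀) * z₀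
      ≤ (a + 2) * C₂ * (d * L ^ 5) + d * L ^ 5 := by
    have e : (1 + shape θ) * reduced θ y - (1 + shape θ₀) * z₀
        = (1 + shape θ) * (reduced θ y - z₀) + (shape θ - shape θ₀) * z₀ := by ring
    rw [e]
    calc _ ≤ |1 + shape θ| * |reduced θ y - z₀| + |shape θ - shape θ₀| * |z₀| := by
          rw [← abs_mul, ← abs_mul]
          exact add_le_add (le_abs_self _) (le_abs_self _)
      _ ≤ (a + 2) * D + d * L := by
          have : |1 + shape θ| ≤ a + 2 := (abs_add_le _ _).trans (by rw [abs_one]; linarith)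
          gcongr
      _ ≤ (a + 2) * (C₂ * d * L ^ 5) + d * L ^ 5 := by gcongr
      _ = _ := by ring
  have t3 : Real.exp (-reduced θ y) - Real.exp (-z₀) ≤ 2 * C₂ * (d * L ^ 5) := by
    have e : Real.exp (-reduced θ y) - Real.exp (-z₀)
        = Real.exp (-z₀) * (Real.exp (z₀ - reduced θ y) - 1) := by
      rw [mul_sub, ← Real.exp_add]
      ring_nf
    have h1 : |z₀ - reduced θ y| ≤ D := by rwa [abs_sub_comm]
    have h2 := Real.abs_exp_sub_one_le (h1.trans hD1)
    calc _ ≤ Real.exp (-z₀) * |Real.exp (z₀ - reduced θ y) - 1| := by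
          rw [e]
          gcongr
          exact le_abs_self _
      _ ≤ L * (2 * D) := by
          gcongr
          linarith
      _ = 2 * C₂ * (d * L ^ 5) := by
          rw [hD]
          ring
  have hsum : h * (d * L ^ 5) + ((a + 2) * C₂ * (d * L ^ 5) + d * L ^ 5)
      + 2 * C₂ * (d * L ^ 5) ≤ ε := by
    refine le_trans (le_of_eq ?_) hε
    rw [hC₃]
    ring
  rw [gevPDF_eq_exp hw, gevPDF_eq_exp hwθ]
  have hlog : ∀ t : ℝ, 0 < t → t⁻¹ = Real.exp (-Real.log t) := fun t ht => by
    rw [Real.exp_neg, Real.exp_log ht]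
  rw [hlog _ hτ, hlog _ hτ₀, ← Real.exp_add, ← Real.exp_add, ← Real.exp_add]
  refine Real.exp_le_exp.2 ?_
  linarith

/-! ### Lower bound for the normalizing constant -/

section Independent

variable {Ω : Type*} [MeasurableSpace Ω] {P : Measure Ω} [IsProbabilityMeasure P] {Y : ℕ → Ω → ℝ}

/-- By the exponential tails and the Borel-Cantelli lemma, the reduced variables of the first `n`
observations are eventually at most `η n` in absolute value, for every `η > 0`. -/
theorem ae_exists_abs_reduced_le {θ₀ : Param} (hθ₀ : θ₀ ∈ paramSpace)
    (hmeas : ∀ i, Measurable (Y i)) (hlaw : ∀ i, HasGEVLaw (Y i) θ₀ P) {η : ℝ} (hη : 0 < η) :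
    ∀ᵐ ω ∂P, ∃ B : ℝ, ∀ n : ℕ, ∀ i < n, |reduced θ₀ (Y i ω)| ≤ B + η * n := by
  have hξ₀ : -1 < shape θ₀ := by linarith [hθ₀.2]
  have htail : ∀ i : ℕ, P {ω | η * i < |reduced θ₀ (Y i ω)|} ≤
      2 * ENNReal.ofReal (Real.exp (-η)) ^ i := by
    intro i
    have hsub : {ω | η * i < |reduced θ₀ (Y i ω)|} ⊆
        {ω | η * i < reduced θ₀ (Y i ω)} ∪ {ω | reduced θ₀ (Y i ω) ≤ -(η * i)} := by
      intro ω hω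
      rcases lt_abs.1 (show η * i < |reduced θ₀ (Y i ω)| from hω) with h | h
      · exact Or.inl h
      · exact Or.inr (le_neg_of_le_neg h.le)
    have e : ENNReal.ofReal (Real.exp (-η)) ^ i = ENNReal.ofReal (Real.exp (-(η * i))) := by
      rw [← ENNReal.ofReal_pow (Real.exp_pos _).le, ← Real.exp_nat_mul]
      congr 2
      ring
    rw [e, two_mul]
    refine (measure_mono hsub).trans ((measure_union_le _ _).trans (add_le_add
      ((hlaw i).measure_lt_reduced_le (hmeas i) hθ₀.1 hξ₀ _)
      (((hlaw i).measure_reduced_le (hmeas i) hθ₀.1 hξ₀ _).trans ?_)))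
    refine ENNReal.ofReal_le_ofReal (Real.exp_le_exp.2 ?_)
    rw [neg_neg]
    linarith [Real.add_one_le_exp (η * i)]
  have hsum : ∑' i : ℕ, P {ω | η * i < |reduced θ₀ (Y i ω)|} ≠ ∞ := by
    refine ne_top_of_le_ne_top ?_ (ENNReal.tsum_le_tsum htail)
    rw [ENNReal.tsum_mul_left, ENNReal.tsum_geometric]
    refine ENNReal.mul_ne_top (by simp) (ENNReal.inv_ne_top.2 (tsub_pos_of_lt ?_).ne')
    rw [← ENNReal.ofReal_one]
    exact (ENNReal.ofReal_lt_ofReal_iff one_pos).2 (Real.exp_lt_one_iff.2 (by linarith))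
  filter_upwards [ae_eventually_notMem hsum] with ω hω
  obtain ⟨N, hN⟩ := eventually_atTop.1 hω
  refine ⟨∑ i ∈ Finset.range N, |reduced θ₀ (Y i ω)|, fun n i hi => ?_⟩
  have hin : (i : ℝ) ≤ n := Nat.cast_le.2 hi.le
  rcases lt_or_ge i N with h | h
  · have h1 := Finset.single_le_sum (f := fun i => |reduced θ₀ (Y i ω)|)
      (fun _ _ => abs_nonneg _) (Finset.mem_range.2 h)
    have h2 : 0 ≤ η * n := by positivity
    linarith
  · have h1 : |reduced θ₀ (Y i ω)| ≤ η * i := not_lt.1 (hN i h)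
    have h2 : 0 ≤ ∑ i ∈ Finset.range N, |reduced θ₀ (Y i ω)| :=
      Finset.sum_nonneg fun _ _ => abs_nonneg _
    have h3 : η * i ≤ η * n := by gcongr
    linarith

/-- The normalizing constant is, up to subexponential factors, at least the likelihood of `θ₀`.
It is bounded below by the integral over a ball around `θ₀` whose radius `exp (-o(n))` is small
enough for every factor `p(Y_i | θ)` with `i < n` to be at least `exp (-ε) p(Y_i | θ₀)`; the
volume of the ball is subexponential too. A fixed neighbourhood of `θ₀` would not do, because it
contains parameters whose support misses some of the observations. -/
theorem ae_exists_le_normConst {θ₀ : Param} (hθ₀ : θ₀ ∈ paramSpace)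
    (hmeas : ∀ i, Measurable (Y i)) (hlaw : ∀ i, HasGEVLaw (Y i) θ₀ P) {π : Param → ℝ}
    (hπ_pos : 0 < π θ₀) (hπ_cont : ContinuousAt π θ₀) {c : ℝ} (hc : 0 < c) :
    ∀ᵐ ω ∂P, ∃ A > 0, ∀ᶠ n : ℕ in atTop,
      ENNReal.ofReal (A * Real.exp (-(c * n)) * ∏ i ∈ Finset.range n, gevPDF θ₀ (Y i ω)) ≤
        normConst π (fun i => Y i ω) n := by
  have hξ₀ : -1 < shape θ₀ := by linarith [hθ₀.2]
  obtain ⟨C, hC, b, hb, hstab⟩ := exists_exp_neg_mul_gevPDF_le hθ₀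
  -- `ε` pays for the likelihood, and `3 * b * η = c / 2` for the volume of the ball.
  set ε := min 1 (c / 2) with hε
  have hε0 : 0 < ε := lt_min one_pos (by linarith)
  set η := c / (6 * b) with hη
  have hη0 : 0 < η := by positivity
  obtain ⟨ρ, hρ, hball⟩ := Metric.eventually_nhds_iff_ball.1
    ((hπ_cont.eventually (lt_mem_nhds (half_lt_self hπ_pos))).and
      (isOpen_paramSpace.mem_nhds hθ₀))
  set V := (volume (Metric.ball (0 : Param) 1)).toReal with hV
  have hVt : volume (Metric.ball (0 : Param) 1) ≠ ∞ := measure_ball_lt_top.ne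
  have hV0 : 0 < V := ENNReal.toReal_pos (Metric.measure_ball_pos volume _ one_pos).ne' hVt
  filter_upwards [ae_exists_abs_reduced_le hθ₀ hmeas hlaw hη0,
    ae_all_iff.2 fun i => (hlaw i).ae_w_pos (hmeas i) hθ₀.1 hξ₀] with ω ⟨B, hB⟩ hw
  set δ : ℕ → ℝ := fun n => ε / C * Real.exp (-(b * (B + η * n))) with hδ
  have hδ0 : ∀ n, 0 < δ n := fun n => by positivity
  have hδlim : Tendsto δ atTop (𝓝 0) := by
    have h1 : Tendsto (fun n : ℕ => b * (B + η * n)) atTop atTop :=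
      (tendsto_atTop_add_const_left _ B
        (tendsto_natCast_atTop_atTop.const_mul_atTop hη0)).const_mul_atTop hb
    simpa using (Real.tendsto_exp_neg_atTop_nhds_zero.comp h1).const_mul (ε / C)
  refine ⟨π θ₀ / 2 * (ε / C) ^ 3 * Real.exp (-(3 * b * B)) * V, by positivity, ?_⟩
  filter_upwards [hδlim.eventually (gt_mem_nhds hρ)] with n hn
  set p₀ := ∏ i ∈ Finset.range n, gevPDF θ₀ (Y i ω) with hp₀
  have hp₀0 : 0 ≤ p₀ := Finset.prod_nonneg fun i _ => gevPDF_nonneg hθ₀.1 _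
  have hsub := Metric.ball_subset_ball (x := θ₀) hn.le
  have hlow : ∀ θ ∈ Metric.ball θ₀ (δ n), ENNReal.ofReal (Real.exp (-(ε * n)) * p₀ * (π θ₀ / 2))
      ≤ ENNReal.ofReal (jointDensity π (fun i => Y i ω) n θ) := by
    intro θ hθ
    obtain ⟨hπθ, hθΘ⟩ := hball θ (hsub hθ)
    refine ENNReal.ofReal_le_ofReal ?_
    rw [jointDensity]
    have hprod : Real.exp (-(ε * n)) * p₀ ≤ ∏ i ∈ Finset.range n, gevPDF θ (Y i ω) := by
      have e : Real.exp (-(ε * n)) * p₀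
          = ∏ i ∈ Finset.range n, (Real.exp (-ε) * gevPDF θ₀ (Y i ω)) := by
        rw [Finset.prod_mul_distrib, Finset.prod_const, Finset.card_range, ← Real.exp_nat_mul,
          hp₀]
        congr 2
        ring
      rw [e]
      refine Finset.prod_le_prod (fun i _ =>
        mul_nonneg (Real.exp_pos _).le (gevPDF_nonneg hθ₀.1 _)) fun i hi => ?_
      refine hstab θ (Y i ω) ε (hw i) (min_le_left _ _) ?_
      rw [Metric.mem_ball, dist_eq_norm] at hθ
      calc C * ‖θ - θ₀‖ * Real.exp (b * |reduced θ₀ (Y i ω)|)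
          ≤ C * δ n * Real.exp (b * (B + η * n)) := by
            have := hB n i (Finset.mem_range.1 hi)
            gcongr
        _ = ε * (Real.exp (-(b * (B + η * n))) * Real.exp (b * (B + η * n))) := by
            simp only [hδ]
            field_simp
        _ = ε := by rw [← Real.exp_add, neg_add_cancel, Real.exp_zero, mul_one]
    gcongr
    exact Finset.prod_nonneg fun i _ => gevPDF_nonneg hθΘ.1 _
  calc ENNReal.ofReal (π θ₀ / 2 * (ε / C) ^ 3 * Real.exp (-(3 * b * B)) * V
        * Real.exp (-(c * n)) * p₀)
      ≤ ENNReal.ofReal (Real.exp (-(ε * n)) * p₀ * (π θ₀ / 2) * (δ n ^ 3 * V)) := by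
        refine ENNReal.ofReal_le_ofReal ?_
        have e : δ n ^ 3 = (ε / C) ^ 3 * (Real.exp (-(3 * b * B)) * Real.exp (-(c / 2 * n))) := by
          simp only [hδ]
          rw [mul_pow, ← Real.exp_nat_mul, ← Real.exp_add]
          congr 2
          rw [hη]
          push_cast
          field_simp
          ring
        have h1 : Real.exp (-(c * n)) ≤ Real.exp (-(ε * n)) * Real.exp (-(c / 2 * n)) := by
          rw [← Real.exp_add]
          refine Real.exp_le_exp.2 ?_
          have : ε * n ≤ c / 2 * n := by
            gcongr
            exact min_le_right _ _
          linarith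
        rw [e]
        calc _ = π θ₀ / 2 * (ε / C) ^ 3 * Real.exp (-(3 * b * B)) * V * p₀
              * Real.exp (-(c * n)) := by ring
          _ ≤ π θ₀ / 2 * (ε / C) ^ 3 * Real.exp (-(3 * b * B)) * V * p₀
              * (Real.exp (-(ε * n)) * Real.exp (-(c / 2 * n))) := by gcongr
          _ = _ := by ring
    _ = ∫⁻ _ in Metric.ball θ₀ (δ n),
          ENNReal.ofReal (Real.exp (-(ε * n)) * p₀ * (π θ₀ / 2)) := by
        rw [setLIntegral_const, Measure.addHaar_ball_of_pos _ _ (hδ0 n),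
          finrank_euclideanSpace_fin, ENNReal.ofReal_mul (by positivity),
          ENNReal.ofReal_mul (by positivity : 0 ≤ δ n ^ 3), hV, ENNReal.ofReal_toReal hVt]
    _ ≤ ∫⁻ θ in Metric.ball θ₀ (δ n),
          ENNReal.ofReal (jointDensity π (fun i => Y i ω) n θ) :=
        setLIntegral_mono' measurableSet_ball hlow
    _ ≤ normConst π (fun i => Y i ω) n :=
        lintegral_mono_set fun θ hθ => (hball θ (hsub hθ)).2

end Independent

end GEV

/-! ### Posterior concentration -/

theorem proposition1 {Ω : Type*} [MeasurableSpace Ω] (P : Measure Ω) [IsProbabilityMeasure P]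
    -- the true parameter
    (θ₀ : GEV.Param) (hθ₀ : θ₀ ∈ GEV.paramSpace)
    -- independent observations from the GEV distribution with parameter `θ₀`
    (Y : ℕ → Ω → ℝ) (hmeas : ∀ i, Measurable (Y i)) (hindep : iIndepFun Y P)
    (hlaw : ∀ i, GEV.HasGEVLaw (Y i) θ₀ P)
    -- a prior density, possibly improper, positive and continuous at `θ₀`
    (π : GEV.Param → ℝ) (hπ_nonneg : ∀ θ ∈ GEV.paramSpace, 0 ≤ π θ)
    (hπ_int : LocallyIntegrableOn π GEV.paramSpace)
    (hπ_pos : 0 < π θ₀) (hπ_cont : ContinuousAt π θ₀)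
    -- a compact neighbourhood of `θ₀` in the parameter space that contains `B_r(θ₀)`
    (r : ℝ) (hr : 0 < r) (K : Set GEV.Param) (hK : IsCompact K) (hK_sub : K ⊆ GEV.paramSpace)
    (hK_nhds : K ∈ 𝓝 θ₀) (hball : GEV.nbhd θ₀ r ⊆ K) :
    ∀ᵐ ω ∂P,
      (∀ᶠ n in atTop, GEV.normConst π (fun i => Y i ω) n ≠ 0) ∧
      Tendsto
        (fun n => ∫⁻ θ in (K ∩ GEV.likelihoodDomain (fun i => Y i ω) n) \ GEV.nbhd θ₀ r,
          GEV.posterior π (fun i => Y i ω) n θ)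
        atTop (𝓝 0) := by
  have hξ₀ : -1 < GEV.shape θ₀ := by linarith [hθ₀.2]
  have hopen : IsOpen (GEV.nbhd θ₀ r) := by
    have e : GEV.nbhd θ₀ r = GEV.paramSpace ∩ Metric.ball θ₀ r := by
      ext θ
      rw [Set.mem_inter_iff, Metric.mem_ball, dist_eq_norm]
      rfl
    rw [e]
    exact GEV.isOpen_paramSpace.inter Metric.isOpen_ball
  have hL : IsCompact (K \ GEV.nbhd θ₀ r) := hK.diff hopen
  have hθ₀L : θ₀ ∉ K \ GEV.nbhd θ₀ r := fun h => h.2 ⟨hθ₀, by simpa using hr⟩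
  obtain ⟨c, hc, hupper⟩ := GEV.exists_likelihood_le_of_isCompact hθ₀ hL
    (Set.sdiff_subset.trans hK_sub) hθ₀L hmeas hindep hlaw
  have hJ : ∫⁻ θ in K, ENNReal.ofReal (π θ) ≠ ∞ := by
    have h1 := (hπ_int.integrableOn_compact_subset hK_sub hK).2
    refine ne_top_of_le_ne_top h1.ne (lintegral_mono fun θ => ?_)
    rw [← ofReal_norm]
    exact ENNReal.ofReal_le_ofReal (le_abs_self _)
  filter_upwards [hupper, GEV.ae_exists_le_normConst hθ₀ hmeas hlaw hπ_pos hπ_cont (half_pos hc),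
    ae_all_iff.2 fun i => (hlaw i).ae_w_pos (hmeas i) hθ₀.1 hξ₀] with ω hup ⟨A, hA, hlow⟩ hw
  have hp₀ : ∀ n, 0 < ∏ i ∈ Finset.range n, GEV.gevPDF θ₀ (Y i ω) := fun n =>
    Finset.prod_pos fun i _ => GEV.gevPDF_pos hθ₀.1 (hw i)
  have hlim : Tendsto (fun n : ℕ => ENNReal.ofReal (A⁻¹ * Real.exp (-(c / 2 * n))) *
      ∫⁻ θ in K, ENNReal.ofReal (π θ)) atTop (𝓝 0) := by
    have h1 : Tendsto (fun n : ℕ => A⁻¹ * Real.exp (-(c / 2 * n))) atTop (𝓝 0) := by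
      simpa using (Real.tendsto_exp_neg_atTop_nhds_zero.comp
        (tendsto_natCast_atTop_atTop.const_mul_atTop (half_pos hc))).const_mul A⁻¹
    simpa using ENNReal.Tendsto.mul_const (ENNReal.tendsto_ofReal h1) (Or.inr hJ)
  refine ⟨?_, tendsto_of_tendsto_of_tendsto_of_le_of_le' tendsto_const_nhds hlim
    (Eventually.of_forall fun n => bot_le) ?_⟩
  · filter_upwards [hlow] with n hn
    have := hp₀ n
    exact (lt_of_lt_of_le (ENNReal.ofReal_pos.2 (by positivity)) hn).ne'
  · filter_upwards [hlow, hup] with n hn hupn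
    have hpn := hp₀ n
    calc _ ≤ ∫⁻ θ in K \ GEV.nbhd θ₀ r, GEV.posterior π (fun i => Y i ω) n θ :=
          lintegral_mono_set (Set.sdiff_subset_sdiff_left Set.inter_subset_left)
      _ ≤ ∫⁻ θ in K \ GEV.nbhd θ₀ r,
            ENNReal.ofReal (A⁻¹ * Real.exp (-(c / 2 * n))) * ENNReal.ofReal (π θ) := by
          refine setLIntegral_mono' hL.measurableSet fun θ hθ => ?_
          have hπθ := hπ_nonneg θ (hK_sub hθ.1)
          rw [GEV.posterior, ← ENNReal.ofReal_mul (by positivity)]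
          refine (ENNReal.div_le_div_left hn _).trans ?_
          rw [← ENNReal.ofReal_div_of_pos (by positivity)]
          refine ENNReal.ofReal_le_ofReal ?_
          rw [div_le_iff₀ (by positivity), GEV.jointDensity]
          have e : Real.exp (-(c * n)) = Real.exp (-(c / 2 * n)) * Real.exp (-(c / 2 * n)) := by
            rw [← Real.exp_add]
            ring_nf
          calc _ ≤ Real.exp (-(c * n)) * (∏ i ∈ Finset.range n, GEV.gevPDF θ₀ (Y i ω)) * π θ :=
                mul_le_mul_of_nonneg_right (hupn θ hθ) hπθ
            _ = _ := by
                rw [e]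
                field_simp
      _ = ENNReal.ofReal (A⁻¹ * Real.exp (-(c / 2 * n))) *
            ∫⁻ θ in K \ GEV.nbhd θ₀ r, ENNReal.ofReal (π θ) :=
          lintegral_const_mul' _ _ ENNReal.ofReal_ne_top
      _ ≤ _ := by
          gcongr
          exact Set.sdiff_subset
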